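/- Let $\lambda_1,\lambda_2,\mu_1,\mu_2>0$, $\rho_i=\lambda_i/\mu_i$, and assume $\rho_1<1/2$ and $\rho_1+\rho_2<1$. Put $\alpha^*=\rho_1/(1-\rho_1)$ and, for $x=(x_1,x_2)\in\mathbb N^2$ and $i\in\{1,2\}$, $$W_i(x)=\frac{\log(1+x_i)}{\log(1+x_1)+\log(1+x_2)},\qquad\text{with the convention } 0/0=0 .$$ Let $\mathcal A_1,\mathcal A_2,\mathcal S_1,\mathcal S_2$ be independent homogeneous Poisson point processes with rate $1$ on $\mathbb R_+^2$. The solution $(L_1,L_2)$ with initial state $(L_1(0),L_2(0))\in\mathbb N^2$ of the stochastic differential equation $$dL_i(t)=\mathcal N_{\lambda_i}(dt)-\mathcal N_{\mu_iW_i(L_1(t-),L_2(t-))}(dt),\qquad i=1,2,$$ is the $\mathbb N^2$-valued process such that, almost surely, for all $t\ge 0$ and $i\in\{1,2\}$, $$L_i(t)=L_i(0)+\#\{(z,u)\in\mathcal A_i: 0<u\le t,\ z\le\lambda_i\}-\#\{(z,u)\in\mathcal S_i: 0<u\le t,\ z\le\mu_iW_i(L_1(u-),L_2(u-))\}.$$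 Let $\kappa>0$. Then there exists $\eta_0>0$ such that, for every sequence $(l_1^N)_{N}$ of non-negative integers with $$\limsup_{N\to+\infty}\left|\frac{l_1^N}{N^{\alpha^*}}-1\right|\le\kappa ,$$ if $(L_1^N,L_2^N)$ denotes the solution with initial state $(l_1^N,N)$, then the following hold. (i) For every $\varepsilon>0$, $$\lim_{N\to+\infty}\mathbb P\left(\sup_{0\le s\le\eta_0N}\left|\frac{L_1^N(s)}{(L_2^N(s))^{\alpha^*}}-1\right|>\kappa+\varepsilon\right)=0 .$$ (ii) If moreover $\limsup_{N\to+\infty}\left|l_1^N/N^{\alpha^*}-1\right|<\kappa$, then $$\lim_{N\to+\infty}\mathbb P\left(\sup_{0\le s\le\eta_0N}\left|\frac{L_1^N(s)}{(L_2^N(s))^{\alpha^*}}-1\right|>\kappa\right)=0 .$$ Here the supremum is taken to be $+\infty$ if $L_2^N(s)=0$ for some $s\le\eta_0N$. -/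

import Mathlib

open MeasureTheory ProbabilityTheory Filter Topology
open scoped ENNReal NNReal

noncomputable section

/-- The number of points of the random set `S` that lie in `B`. -/
def pointCount {Ω E : Type*} (S : Ω → Set E) (B : Set E) (ω : Ω) : ℕ∞ :=
  (S ω ∩ B).encard

/-- `S` is a Poisson point process on `E` with intensity measure `ν`: the number of points in a
measurable set of finite intensity is Poisson distributed, and the numbers of points in disjoint
measurable sets are independent. -/
structure IsPoissonPointProcess {Ω E : Type*} [MeasurableSpace Ω] [MeasurableSpace E]
    (P : Measure Ω) (ν : Measure E) (S : Ω → Set E) : Prop where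
  measurable_pointCount : ∀ B : Set E, MeasurableSet B → Measurable (pointCount S B)
  hasLaw_pointCount : ∀ B : Set E, MeasurableSet B → ν B ≠ ∞ →
    HasLaw (pointCount S B)
      ((poissonMeasure (ν B).toNNReal).map (fun k : ℕ => (k : ℕ∞))) P
  iIndepFun_pointCount : ∀ (n : ℕ) (B : Fin n → Set E), (∀ k, MeasurableSet (B k)) →
    Pairwise (fun j k => Disjoint (B j) (B k)) → iIndepFun (fun k => pointCount S (B k)) P

/-- The σ-algebra generated by a point process. -/
abbrev pointSigma {Ω E : Type*} [MeasurableSpace E] (S : Ω → Set E) : MeasurableSpace Ω :=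
  ⨆ B : {B : Set E // MeasurableSet B}, MeasurableSpace.comap (pointCount S B.1) inferInstance

/-- The intensity of the homogeneous Poisson point process with rate `1` on `ℝ₊ × ℝ₊`. -/
def quadrantIntensity : Measure (ℝ × ℝ) :=
  volume.restrict (Set.Ici 0 ×ˢ Set.Ici 0)

/-- The arrival and service noises of the two queues: four independent homogeneous Poisson point
processes with rate `1` on `ℝ₊ × ℝ₊`. -/
structure IsPoissonNoise {Ω : Type*} [MeasurableSpace Ω] (P : Measure Ω)
    (arr srv : Fin 2 → Ω → Set (ℝ × ℝ)) : Prop where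
  arr_poisson : ∀ i, IsPoissonPointProcess P quadrantIntensity (arr i)
  srv_poisson : ∀ i, IsPoissonPointProcess P quadrantIntensity (srv i)
  independent : iIndep (fun j : Fin 2 ⊕ Fin 2 => pointSigma (Sum.elim arr srv j)) P

/-- `∫_{(0,t]} 𝒩_{h(u)}(du)`: the number of points `(z, u)` of `S` with `0 < u ≤ t` and
`0 ≤ z ≤ h u`. -/
def thinnedCount (S : Set (ℝ × ℝ)) (h : ℝ → ℝ) (t : ℝ) : ℕ∞ :=
  {p : ℝ × ℝ | p ∈ S ∧ 0 < p.2 ∧ p.2 ≤ t ∧ 0 ≤ p.1 ∧ p.1 ≤ h p.2}.encard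

/-- The fraction of service given to queue `i` in state `x`; it is `0` in the empty state, as
`0 / 0 = 0`. -/
def serviceShare (x : Fin 2 → ℕ) (i : Fin 2) : ℝ :=
  Real.log (1 + x i) / (Real.log (1 + x 0) + Real.log (1 + x 1))

/-- `L` solves, almost surely, the stochastic differential equation
`dL_i(t) = 𝒩_{lam_i}(dt) - 𝒩_{mu_i W_i(L(t-))}(dt)`, `L(0) = x₀`, in integrated form; departures
stand on the left-hand side so that no subtraction occurs. -/
def IsQueueSolution {Ω : Type*} [MeasurableSpace Ω] (P : Measure Ω)
    (arr srv : Fin 2 → Ω → Set (ℝ × ℝ)) (lam mu : Fin 2 → ℝ) (x₀ : Fin 2 → ℕ)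
    (L : ℝ → Ω → Fin 2 → ℕ) : Prop :=
  ∀ᵐ ω ∂P, ∀ t : ℝ, 0 ≤ t → ∀ i : Fin 2,
    (L t ω i : ℕ∞) +
        thinnedCount (srv i ω)
          (fun u => mu i * serviceShare (Function.leftLim (fun s => L s ω) u) i) t =
      (x₀ i : ℕ∞) + thinnedCount (arr i ω) (fun _ => lam i) t

/-- `|x / y ^ α - 1|`, with the value `∞` if `y = 0`. -/
def ratioDev (α : ℝ) (x y : ℕ) : ℝ≥0∞ :=
  if y = 0 then ∞ else ENNReal.ofReal |(x : ℝ) / (y : ℝ) ^ α - 1|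

/-- The supremum of `|L₁(s) / L₂(s) ^ α - 1|` over `0 ≤ s ≤ T`; queues `1` and `2` have the
indices `0` and `1`. -/
def supRatioDev {Ω : Type*} (α : ℝ) (L : ℝ → Ω → Fin 2 → ℕ) (T : ℝ) (ω : Ω) : ℝ≥0∞ :=
  ⨆ s ∈ Set.Icc (0 : ℝ) T, ratioDev α (L s ω 0) (L s ω 1)

/-- The exponent `α* = ρ / (1 - ρ)`. -/
def alphaStar (ρ : ℝ) : ℝ := ρ / (1 - ρ)

end

/-! ### Exponential bounds for Poisson counts -/

/-! On the curve L₁ = a L₂^α*, the logarithms give W₁ ≈ α*/(1 + α*) = ρ₁, with a correction of order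
log a / log L₂. So L₁ is pulled back towards the curve a = 1 with a drift of order 1/log N: from
above when a > 1 (`exists_add_div_le_serviceShare`), from below when a < 1
(`exists_serviceShare_le_sub_div`). Up to time N/(4μ₂) the second queue remains between N/4 and a
multiple of N (`second_queue_bounds`), so this drift is uniform in time.

Take an inner level a and an outer level b. After the last visit inside level a, L₁ is compared with
a difference of two Poisson counts of constant rates whose drift is of order 1/log N. By Chernoff,
such a walk moves against its drift by e N^α* with probability at most exp(-c N^α*/log N), which
beats the O(N²) pairs of integer times over which the union bound is taken. Off these bad events,
the excursion must be short: drift over a time τN is of order N/log N, which dominates N^α* because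
α* < 1. During a short excursion L₂ changes by a small proportion only, so the path cannot pass from
level a to level b (`le_mul_rpow_of_excursion`, `mul_rpow_le_of_excursion`).

The probability enters only through counts on fixed rectangles; everything else is a pathwise
argument, with no stopping times or martingales. `exists_measure_upper_exit_le` and
`exists_measure_lower_exit_le` assemble the two sides. -/

lemma lintegral_exp_mul_poissonMeasure (r : ℝ≥0) (θ : ℝ) :
    ∫⁻ n, ENNReal.ofReal (Real.exp (θ * (n : ℝ))) ∂(poissonMeasure r) =
      ENNReal.ofReal (Real.exp (r * (Real.exp θ - 1))) := by
  have hs : HasSum (fun n : ℕ => Real.exp (-r) * (r * Real.exp θ) ^ n / (n.factorial : ℝ))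
      (Real.exp (r * (Real.exp θ - 1))) := by
    convert! (NormedSpace.expSeries_div_hasSum_exp (r * Real.exp θ : ℝ)).mul_left
      (Real.exp (-r)) using 1
    · simp_rw [mul_div_assoc]
    · rw [← Real.exp_eq_exp_ℝ, ← Real.exp_add]
      ring_nf
  rw [poissonMeasure, lintegral_sum_measure, ← hs.tsum_eq,
    ENNReal.ofReal_tsum_of_nonneg (fun n => by positivity) hs.summable]
  refine tsum_congr fun n => ?_
  rw [lintegral_smul_measure, lintegral_dirac, smul_eq_mul,
    ← ENNReal.ofReal_mul (by positivity), mul_pow, ← Real.exp_nat_mul, mul_comm θ]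
  ring_nf

lemma IsPoissonPointProcess.lintegral_exp_mul_ncard {Ω E : Type*} [MeasurableSpace Ω]
    [MeasurableSpace E] {P : Measure Ω} {ν : Measure E} {S : Ω → Set E}
    (hS : IsPoissonPointProcess P ν S) {B : Set E} (hB : MeasurableSet B) (hν : ν B ≠ ∞) (θ : ℝ) :
    ∫⁻ ω, ENNReal.ofReal (Real.exp (θ * ((S ω ∩ B).ncard : ℝ))) ∂P =
      ENNReal.ofReal (Real.exp ((ν B).toReal * (Real.exp θ - 1))) := by
  -- `ncard` is `toNat` of the count, and the law is carried by finite values, so the default value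
  -- at `⊤` is immaterial.
  have h := (hS.hasLaw_pointCount B hB hν).lintegral_comp
    (f := fun k : ℕ∞ => ENNReal.ofReal (Real.exp (θ * (k.toNat : ℝ)))) (by fun_prop)
  rw [lintegral_map (by fun_prop) (by fun_prop)] at h
  refine Eq.trans h ?_
  simp only [ENat.toNat_natCast]
  exact lintegral_exp_mul_poissonMeasure _ θ

lemma IsPoissonPointProcess.ae_finite {Ω E : Type*} [MeasurableSpace Ω]
    [MeasurableSpace E] {P : Measure Ω} {ν : Measure E} {S : Ω → Set E}
    (hS : IsPoissonPointProcess P ν S) {B : Set E} (hB : MeasurableSet B) (hν : ν B ≠ ∞) :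
    ∀ᵐ ω ∂P, (S ω ∩ B).Finite := by
  have h := (hS.hasLaw_pointCount B hB hν).ae_iff (p := fun k : ℕ∞ => k ≠ ⊤)
    (measurable_from_top)
  simp only [pointCount, Set.encard_ne_top_iff] at h
  rw [h, ae_map_iff (by fun_prop) (by measurability)]
  simp

lemma measurable_pointSigma_ncard {Ω E : Type*} [MeasurableSpace E] (S : Ω → Set E) {B : Set E}
    (hB : MeasurableSet B) :
    Measurable[pointSigma S] fun ω => (S ω ∩ B).ncard := by
  have h1 : Measurable[pointSigma S] (pointCount S B) := by
    refine Measurable.mono (comap_measurable _) ?_ le_rfl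
    exact le_iSup (fun B : {B : Set E // MeasurableSet B} =>
      MeasurableSpace.comap (pointCount S B.1) inferInstance) ⟨B, hB⟩
  have h2 : Measurable (fun k : ℕ∞ => k.toNat) := measurable_from_top
  exact h2.comp h1

lemma pointSigma_le {Ω E : Type*} [MeasurableSpace Ω] [MeasurableSpace E] {P : Measure Ω}
    {ν : Measure E} {S : Ω → Set E} (hS : IsPoissonPointProcess P ν S) :
    pointSigma S ≤ ‹MeasurableSpace Ω› :=
  iSup_le fun B => (hS.measurable_pointCount B.1 B.2).comap_le

/-- The Chernoff bound for the difference of the numbers of points of two independent Poisson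
processes. -/
lemma measure_le_ncard_sub_ncard {Ω E : Type*} [MeasurableSpace Ω] [MeasurableSpace E]
    {P : Measure Ω} {ν : Measure E} {S S' : Ω → Set E} (hS : IsPoissonPointProcess P ν S)
    (hS' : IsPoissonPointProcess P ν S') (hind : Indep (pointSigma S) (pointSigma S') P)
    {B B' : Set E} (hB : MeasurableSet B) (hν : ν B ≠ ∞) (hB' : MeasurableSet B')
    (hν' : ν B' ≠ ∞) {θ : ℝ} (hθ : 0 ≤ θ) (x : ℝ) :
    P {ω | x ≤ ((S ω ∩ B).ncard : ℝ) - (S' ω ∩ B').ncard} ≤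
      ENNReal.ofReal (Real.exp ((ν B).toReal * (Real.exp θ - 1) +
        (ν B').toReal * (Real.exp (-θ) - 1) - θ * x)) := by
  set f : Ω → ℝ≥0∞ := fun ω => ENNReal.ofReal (Real.exp (θ * ((S ω ∩ B).ncard : ℝ))) with hf
  set g : Ω → ℝ≥0∞ := fun ω => ENNReal.ofReal (Real.exp (-θ * ((S' ω ∩ B').ncard : ℝ))) with hg
  have hfm : Measurable[pointSigma S] f :=
    (measurable_from_top (f := fun n : ℕ => ENNReal.ofReal (Real.exp (θ * (n : ℝ))))).comp
      (measurable_pointSigma_ncard S hB)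
  have hgm : Measurable[pointSigma S'] g :=
    (measurable_from_top (f := fun n : ℕ => ENNReal.ofReal (Real.exp (-θ * (n : ℝ))))).comp
      (measurable_pointSigma_ncard S' hB')
  have hprod := lintegral_mul_eq_lintegral_mul_lintegral_of_independent_measurableSpace
    (pointSigma_le hS) (pointSigma_le hS') hind hfm hgm
  rw [hS.lintegral_exp_mul_ncard hB hν, hS'.lintegral_exp_mul_ncard hB' hν',
    ← ENNReal.ofReal_mul (by positivity), ← Real.exp_add] at hprod
  have hmk := mul_meas_ge_le_lintegral₀ (μ := P) (f := fun ω => f ω * g ω)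
    (((hfm.mono (pointSigma_le hS) le_rfl).mul
      (hgm.mono (pointSigma_le hS') le_rfl)).aemeasurable) (ENNReal.ofReal (Real.exp (θ * x)))
  rw [hprod] at hmk
  have hsub : {ω | x ≤ ((S ω ∩ B).ncard : ℝ) - (S' ω ∩ B').ncard} ⊆
      {ω | ENNReal.ofReal (Real.exp (θ * x)) ≤ f ω * g ω} := by
    intro ω hω
    simp only [Set.mem_ofPred_eq, hf, hg] at hω ⊢
    rw [← ENNReal.ofReal_mul (by positivity), ← Real.exp_add]
    refine ENNReal.ofReal_le_ofReal (Real.exp_le_exp.2 ?_)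
    nlinarith [mul_le_mul_of_nonneg_left hω hθ]
  refine (measure_mono hsub).trans ?_
  rw [sub_eq_add_neg _ (θ * x), Real.exp_add _ (-(θ * x)), ENNReal.ofReal_mul (by positivity),
    Real.exp_neg (θ * x), ENNReal.ofReal_inv_of_pos (by positivity), ← div_eq_mul_inv]
  rw [ENNReal.le_div_iff_mul_le (Or.inl (by simp [Real.exp_pos])) (Or.inl (by simp)), mul_comm]
  exact hmk

/-- A random walk with negative drift rarely makes a large upward excursion: the Chernoff bound at a
parameter proportional to the drift `b - a`. -/
lemma measure_le_ncard_sub_ncard_of_drift {Ω E : Type*} [MeasurableSpace Ω] [MeasurableSpace E]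
    {P : Measure Ω} {ν : Measure E} {S S' : Ω → Set E} (hS : IsPoissonPointProcess P ν S)
    (hS' : IsPoissonPointProcess P ν S') (hind : Indep (pointSigma S) (pointSigma S') P)
    {B B' : Set E} (hB : MeasurableSet B) (hν : ν B ≠ ∞) (hB' : MeasurableSet B')
    (hν' : ν B' ≠ ∞) {a b M C n : ℝ} (ha : 0 ≤ a) (hab : a < b) (hbM : b ≤ M) (hC : 0 ≤ C)
    (hn : 0 ≤ n) (hBn : (ν B).toReal ≤ a * n + C) (hBn' : b * n - C ≤ (ν B').toReal) (x : ℝ) :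
    P {ω | x - (b - a) / 2 * n ≤ ((S ω ∩ B).ncard : ℝ) - (S' ω ∩ B').ncard} ≤
      ENNReal.ofReal (Real.exp ((b - a) / (4 * M) * (3 * C - x))) := by
  have hM : 0 < M := by linarith
  -- With this θ the second-order terms cost 2Mnθ² = θ(b - a)n/2, half of the drift; the other half
  -- is the slope allowed in the event.
  set θ := (b - a) / (4 * M) with hθdef
  have hθ : 0 < θ := div_pos (by linarith) (by linarith)
  have hθ1 : θ ≤ 1 := by
    rw [hθdef, div_le_one (by linarith)]
    linarith
  have hθM : θ * (4 * M) = b - a := by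
    rw [hθdef]
    field_simp
  refine (measure_le_ncard_sub_ncard hS hS' hind hB hν hB' hν' hθ.le _).trans
    (ENNReal.ofReal_le_ofReal (Real.exp_le_exp.2 ?_))
  have e1 : Real.exp θ - 1 ≤ θ + θ ^ 2 := by
    have := (abs_le.1 (Real.abs_exp_sub_one_sub_id_le (x := θ) (by rw [abs_of_pos hθ]; exact hθ1))).2
    linarith
  have e2 : Real.exp (-θ) - 1 ≤ -θ + θ ^ 2 := by
    have := (abs_le.1 (Real.abs_exp_sub_one_sub_id_le (x := -θ)
      (by rw [abs_neg, abs_of_pos hθ]; exact hθ1))).2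
    nlinarith
  have h1 : (ν B).toReal * (Real.exp θ - 1) ≤ (a * n + C) * (θ + θ ^ 2) :=
    (mul_le_mul_of_nonneg_left e1 ENNReal.toReal_nonneg).trans
      (mul_le_mul_of_nonneg_right hBn (by positivity))
  have h2 : (ν B').toReal * (Real.exp (-θ) - 1) ≤ (b * n - C) * (-θ + θ ^ 2) :=
    (mul_le_mul_of_nonneg_left e2 ENNReal.toReal_nonneg).trans
      (mul_le_mul_of_nonpos_right hBn' (by nlinarith))
  have h3 : (a + b) * n * θ ^ 2 ≤ 2 * M * n * θ ^ 2 := by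
    have : a + b ≤ 2 * M := by linarith
    gcongr
  have h4 : 2 * M * n * θ ^ 2 = θ * ((b - a) / 2 * n) := by
    rw [← hθM]; ring
  have h5 : C * θ ^ 2 ≤ C * θ := by
    have : θ ^ 2 ≤ θ := by nlinarith
    gcongr
  nlinarith [mul_nonneg hC (sq_nonneg θ), mul_nonneg hC hθ.le]

/-- Chernoff at θ = 1, using e - 1 < 2. The second process is observed on the empty set only, so
that the two-process bound applies. -/
lemma measure_two_mul_add_le_ncard {Ω E : Type*} [MeasurableSpace Ω] [MeasurableSpace E]
    {P : Measure Ω} {ν : Measure E} {S S' : Ω → Set E} (hS : IsPoissonPointProcess P ν S)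
    (hS' : IsPoissonPointProcess P ν S') (hind : Indep (pointSigma S) (pointSigma S') P)
    {B : Set E} (hB : MeasurableSet B) (hν : ν B ≠ ∞) (x : ℝ) :
    P {ω | 2 * (ν B).toReal + x ≤ ((S ω ∩ B).ncard : ℝ)} ≤ ENNReal.ofReal (Real.exp (-x)) := by
  have h := measure_le_ncard_sub_ncard hS hS' hind hB hν MeasurableSet.empty (by simp)
    zero_le_one (2 * (ν B).toReal + x)
  simp only [Set.inter_empty, Set.ncard_empty, Nat.cast_zero, sub_zero] at h
  refine h.trans (ENNReal.ofReal_le_ofReal (Real.exp_le_exp.2 ?_))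
  have := Real.exp_one_lt_d9
  simp only [measure_empty, ENNReal.toReal_zero]
  nlinarith [ENNReal.toReal_nonneg (a := ν B)]

/-! ### Paths of the queueing system -/

/-- A path of the queueing system driven by the locally finite point sets `A` and `S`. -/
structure IsQueuePath (A S : Fin 2 → Set (ℝ × ℝ)) (lam mu : Fin 2 → ℝ) (x₀ : Fin 2 → ℕ)
    (l : ℝ → Fin 2 → ℕ) : Prop where
  arr_finite : ∀ i, ∀ n : ℕ, (A i ∩ Set.Icc 0 (n : ℝ) ×ˢ Set.Icc 0 (n : ℝ)).Finite
  srv_finite : ∀ i, ∀ n : ℕ, (S i ∩ Set.Icc 0 (n : ℝ) ×ˢ Set.Icc 0 (n : ℝ)).Finite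
  balance : ∀ t : ℝ, 0 ≤ t → ∀ i : Fin 2,
    (l t i : ℕ∞) + thinnedCount (S i) (fun u => mu i * serviceShare (Function.leftLim l u) i) t =
      (x₀ i : ℕ∞) + thinnedCount (A i) (fun _ => lam i) t

/-- The rectangle of the points `(z, u)` with `0 ≤ z ≤ h` and `s < u ≤ t`. -/
def strip (h s t : ℝ) : Set (ℝ × ℝ) := Set.Icc 0 h ×ˢ Set.Ioc s t

/-- The points `(z, u)` with `0 ≤ z ≤ h u` and `s < u ≤ t`. -/
def stripUnder (h : ℝ → ℝ) (s t : ℝ) : Set (ℝ × ℝ) :=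
  {p | s < p.2 ∧ p.2 ≤ t ∧ 0 ≤ p.1 ∧ p.1 ≤ h p.2}

/-- The rate at which queue `i` is served along the path `l`. -/
noncomputable def serviceRate (mu : Fin 2 → ℝ) (l : ℝ → Fin 2 → ℕ) (i : Fin 2) (u : ℝ) : ℝ :=
  mu i * serviceShare (Function.leftLim l u) i

lemma stripUnder_const (h s t : ℝ) : stripUnder (fun _ => h) s t = strip h s t := by
  ext p
  simp only [stripUnder, strip, Set.mem_ofPred_eq, Set.mem_prod, Set.mem_Icc, Set.mem_Ioc]
  tauto

lemma stripUnder_subset_stripUnder {h h' : ℝ → ℝ} {s t s' t' : ℝ} (hs : s' ≤ s) (ht : t ≤ t')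
    (hh : ∀ u, s < u → u ≤ t → h u ≤ h' u) : stripUnder h s t ⊆ stripUnder h' s' t' :=
  fun _ hp => ⟨hs.trans_lt hp.1, hp.2.1.trans ht, hp.2.2.1, hp.2.2.2.trans (hh _ hp.1 hp.2.1)⟩

lemma strip_subset_strip {h h' s t s' t' : ℝ} (hh : h ≤ h') (hs : s' ≤ s) (ht : t ≤ t') :
    strip h s t ⊆ strip h' s' t' := by
  rw [← stripUnder_const, ← stripUnder_const]
  exact stripUnder_subset_stripUnder hs ht fun _ _ _ => hh

lemma finite_inter_strip {S : Set (ℝ × ℝ)}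
    (hS : ∀ n : ℕ, (S ∩ Set.Icc 0 (n : ℝ) ×ˢ Set.Icc 0 (n : ℝ)).Finite) (h t : ℝ) {s : ℝ}
    (hs : 0 ≤ s) : (S ∩ strip h s t).Finite := by
  obtain ⟨n, hn⟩ := exists_nat_ge (max h t)
  refine (hS n).subset (Set.inter_subset_inter_right _ ?_)
  rintro p ⟨⟨h1, h2⟩, h3, h4⟩
  exact ⟨⟨h1, h2.trans ((le_max_left _ _).trans hn)⟩, hs.trans h3.le,
    h4.trans ((le_max_right _ _).trans hn)⟩

lemma finite_inter_stripUnder {S : Set (ℝ × ℝ)}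
    (hS : ∀ n : ℕ, (S ∩ Set.Icc 0 (n : ℝ) ×ˢ Set.Icc 0 (n : ℝ)).Finite) {h : ℝ → ℝ} {M : ℝ}
    (hh : ∀ u, h u ≤ M) (t : ℝ) {s : ℝ} (hs : 0 ≤ s) : (S ∩ stripUnder h s t).Finite := by
  refine (finite_inter_strip hS M t hs).subset (Set.inter_subset_inter_right _ ?_)
  rw [← stripUnder_const]
  exact stripUnder_subset_stripUnder le_rfl le_rfl fun u _ _ => hh u

lemma thinnedCount_eq_encard (S : Set (ℝ × ℝ)) (h : ℝ → ℝ) (t : ℝ) :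
    thinnedCount S h t = (S ∩ stripUnder h 0 t).encard := rfl

lemma thinnedCount_eq_add (S : Set (ℝ × ℝ)) (h : ℝ → ℝ) {s t : ℝ} (hs : 0 ≤ s) (hst : s ≤ t) :
    thinnedCount S h t = thinnedCount S h s + (S ∩ stripUnder h s t).encard := by
  rw [thinnedCount_eq_encard, thinnedCount_eq_encard, ← Set.encard_union_eq]
  · congr 1
    ext p
    simp only [stripUnder, Set.mem_inter_iff, Set.mem_union, Set.mem_ofPred_eq]
    constructor
    · rintro ⟨hp, h1, h2, h3⟩
      rcases le_or_gt p.2 s with h | h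
      · exact Or.inl ⟨hp, h1, h, h3⟩
      · exact Or.inr ⟨hp, h, h2, h3⟩
    · rintro (⟨hp, h1, h2, h3⟩ | ⟨hp, h1, h2, h3⟩)
      · exact ⟨hp, h1, h2.trans hst, h3⟩
      · exact ⟨hp, hs.trans_lt h1, h2, h3⟩
  · rw [Set.disjoint_left]
    rintro p ⟨-, -, h2, -⟩ ⟨-, h3, -⟩
    exact absurd h2 (not_le.2 h3)

lemma serviceShare_le_one (x : Fin 2 → ℕ) (i : Fin 2) : serviceShare x i ≤ 1 := by
  have h : ∀ j, 0 ≤ Real.log (1 + (x j : ℝ)) := fun j =>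
    Real.log_nonneg (by linarith [(x j).cast_nonneg (α := ℝ)])
  refine div_le_one_of_le₀ ?_ (add_nonneg (h 0) (h 1))
  fin_cases i
  · simpa using h 1
  · simpa using h 0

lemma serviceRate_le {mu : Fin 2 → ℝ} (hmu : ∀ i, 0 < mu i) (l : ℝ → Fin 2 → ℕ) (i : Fin 2)
    (u : ℝ) : serviceRate mu l i u ≤ mu i :=
  mul_le_of_le_one_right (hmu i).le (serviceShare_le_one _ _)

namespace IsQueuePath

variable {A S : Fin 2 → Set (ℝ × ℝ)} {lam mu : Fin 2 → ℝ} {x₀ : Fin 2 → ℕ} {l : ℝ → Fin 2 → ℕ}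

lemma finite_departures (hl : IsQueuePath A S lam mu x₀ l) (hmu : ∀ i, 0 < mu i) (i : Fin 2)
    {s : ℝ} (hs : 0 ≤ s) (t : ℝ) : (S i ∩ stripUnder (serviceRate mu l i) s t).Finite :=
  finite_inter_stripUnder (hl.srv_finite i) (serviceRate_le hmu l i) t hs

lemma initial (hl : IsQueuePath A S lam mu x₀ l) : l 0 = x₀ := by
  ext i
  have h := hl.balance 0 le_rfl i
  have h0 : ∀ h : ℝ → ℝ, stripUnder h 0 0 = ∅ := fun h => by
    ext p
    simp only [stripUnder, Set.mem_ofPred_eq, Set.mem_empty_iff_false, iff_false]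
    rintro ⟨h1, h2, -⟩
    linarith
  simpa [thinnedCount_eq_encard, h0] using h

lemma increment (hl : IsQueuePath A S lam mu x₀ l) (hmu : ∀ i, 0 < mu i) (i : Fin 2) {s t : ℝ}
    (hs : 0 ≤ s) (hst : s ≤ t) :
    (l t i : ℝ) - l s i = ((A i ∩ strip (lam i) s t).ncard : ℝ) -
      (S i ∩ stripUnder (serviceRate mu l i) s t).ncard := by
  have h1 := hl.balance t (hs.trans hst) i
  have h2 := hl.balance s hs i
  rw [thinnedCount_eq_add _ _ hs hst, thinnedCount_eq_add _ _ hs hst, stripUnder_const,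
    ← add_assoc, ← add_assoc, ← h2, thinnedCount_eq_encard] at h1
  change _ + (S i ∩ stripUnder (serviceRate mu l i) 0 s).encard +
    (S i ∩ stripUnder (serviceRate mu l i) s t).encard =
    _ + (S i ∩ stripUnder (serviceRate mu l i) 0 s).encard + _ at h1
  -- Cancellation fails at `⊤`; finiteness of the counts brings the identity down to ℕ.
  rw [← (hl.finite_departures hmu i le_rfl s).cast_ncard_eq,
    ← (hl.finite_departures hmu i hs t).cast_ncard_eq,
    ← (finite_inter_strip (hl.arr_finite i) (lam i) t hs).cast_ncard_eq] at h1
  have h3 : l t i + (S i ∩ stripUnder (serviceRate mu l i) 0 s).ncard +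
    (S i ∩ stripUnder (serviceRate mu l i) s t).ncard =
    l s i + (S i ∩ stripUnder (serviceRate mu l i) 0 s).ncard +
      (A i ∩ strip (lam i) s t).ncard := by exact_mod_cast h1
  have h4 : l t i + (S i ∩ stripUnder (serviceRate mu l i) s t).ncard =
    l s i + (A i ∩ strip (lam i) s t).ncard := by omega
  have h5 : (l t i : ℝ) + (S i ∩ stripUnder (serviceRate mu l i) s t).ncard =
    l s i + (A i ∩ strip (lam i) s t).ncard := by exact_mod_cast h4
  linarith

end IsQueuePath

lemma exists_eventually_eq_nhdsLT {f : ℝ → ℕ} {u : ℝ} (hu : 0 < u)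
    (hf : ∀ s t, 0 ≤ s → s ≤ t → t ≤ u → f s ≤ f t) : ∃ c, ∀ᶠ v in 𝓝[<] u, f v = c := by
  have hbdd : BddAbove (f '' Set.Ico 0 u) := by
    refine ⟨f u, ?_⟩
    rintro _ ⟨v, hv, rfl⟩
    exact hf v u hv.1 hv.2.le le_rfl
  obtain ⟨w, hw, hwe⟩ := Nat.sSup_mem (⟨f 0, 0, ⟨le_rfl, hu⟩, rfl⟩ : (f '' Set.Ico 0 u).Nonempty)
    hbdd
  refine ⟨f w, ?_⟩
  filter_upwards [Ico_mem_nhdsLT hw.2] with v hv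
  refine le_antisymm ?_ (hf w v hw.1 hv.1 hv.2.le)
  rw [hwe]
  exact le_csSup hbdd ⟨v, ⟨hw.1.trans hv.1, hv.2⟩, rfl⟩

namespace IsQueuePath

variable {A S : Fin 2 → Set (ℝ × ℝ)} {lam mu : Fin 2 → ℝ} {x₀ : Fin 2 → ℕ} {l : ℝ → Fin 2 → ℕ}

/-- The left limits of a path are values that it takes just before. -/
lemma exists_leftLim_eq (hl : IsQueuePath A S lam mu x₀ l) (hmu : ∀ i, 0 < mu i) {s u : ℝ}
    (hs : 0 ≤ s) (hsu : s < u) : ∃ v ∈ Set.Ioo s u, Function.leftLim l u = l v := by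
  have hu : 0 < u := hs.trans_lt hsu
  -- By the balance equation each coordinate is a difference of monotone integer counts, each
  -- constant just before `u`. The existence of left limits thus follows without any regularity
  -- assumed of the path.
  have key : ∀ i, ∃ c : ℕ, ∀ᶠ v in 𝓝[<] u, l v i = c := by
    intro i
    obtain ⟨a, ha⟩ := exists_eventually_eq_nhdsLT
      (f := fun t => (A i ∩ strip (lam i) 0 t).ncard) hu fun s t _ hst _ =>
        Set.ncard_le_ncard (Set.inter_subset_inter_right _ (strip_subset_strip le_rfl le_rfl hst))
          (finite_inter_strip (hl.arr_finite i) (lam i) t le_rfl)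
    obtain ⟨d, hd⟩ := exists_eventually_eq_nhdsLT
      (f := fun t => (S i ∩ stripUnder (serviceRate mu l i) 0 t).ncard) hu fun s t _ hst _ =>
        Set.ncard_le_ncard (Set.inter_subset_inter_right _
          (stripUnder_subset_stripUnder le_rfl hst fun _ _ _ => le_rfl))
          (hl.finite_departures hmu i le_rfl t)
    refine ⟨l 0 i + a - d, ?_⟩
    filter_upwards [ha, hd, Ioo_mem_nhdsLT hu] with v hva hvd hv
    have h := hl.increment hmu i le_rfl hv.1.le
    rw [hva, hvd] at h
    have h' : l v i + d = l 0 i + a := by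
      have : (l v i : ℝ) + d = l 0 i + a := by linarith
      exact_mod_cast this
    omega
  choose c hc using key
  have hev : ∀ᶠ v in 𝓝[<] u, l v = c := by
    filter_upwards [eventually_all.2 hc] with v hv
    exact funext hv
  have hlim : Function.leftLim l u = c :=
    leftLim_eq_of_tendsto (tendsto_const_nhds.congr' (hev.mono fun v hv => hv.symm))
  obtain ⟨v, hv, hv'⟩ := (hev.and (Ioo_mem_nhdsLT hsu)).exists
  exact ⟨v, hv', hlim.trans hv.symm⟩

end IsQueuePath

lemma measurableSet_strip (h s t : ℝ) : MeasurableSet (strip h s t) :=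
  measurableSet_Icc.prod measurableSet_Ioc

lemma quadrantIntensity_strip (h t : ℝ) {s : ℝ} (hs : 0 ≤ s) :
    quadrantIntensity (strip h s t) = ENNReal.ofReal h * ENNReal.ofReal (t - s) := by
  rw [quadrantIntensity, Measure.restrict_apply (measurableSet_strip h s t),
    Set.inter_eq_left.2, strip, Measure.volume_eq_prod, Measure.prod_prod, Real.volume_Icc,
    Real.volume_Ioc, sub_zero]
  rintro p ⟨⟨h1, -⟩, h3, -⟩
  exact ⟨h1, hs.trans h3.le⟩

lemma quadrantIntensity_strip_ne_top (h t : ℝ) {s : ℝ} (hs : 0 ≤ s) :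
    quadrantIntensity (strip h s t) ≠ ∞ := by
  rw [quadrantIntensity_strip h t hs]
  exact ENNReal.mul_ne_top ENNReal.ofReal_ne_top ENNReal.ofReal_ne_top

lemma toReal_quadrantIntensity_strip {h s t : ℝ} (hh : 0 ≤ h) (hs : 0 ≤ s) (hst : s ≤ t) :
    (quadrantIntensity (strip h s t)).toReal = h * (t - s) := by
  rw [quadrantIntensity_strip h t hs, ENNReal.toReal_mul, ENNReal.toReal_ofReal hh,
    ENNReal.toReal_ofReal (sub_nonneg.2 hst)]

lemma mul_sub_le_toReal_quadrantIntensity_strip {h s t : ℝ} (hh : 0 ≤ h) (hs : 0 ≤ s) :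
    h * (t - s) ≤ (quadrantIntensity (strip h s t)).toReal := by
  rw [quadrantIntensity_strip h t hs, ENNReal.toReal_mul, ENNReal.toReal_ofReal hh]
  exact mul_le_mul_of_nonneg_left (Real.le_coe_toNNReal _) hh

lemma quadrantIntensity_square_ne_top (n : ℕ) :
    quadrantIntensity (Set.Icc 0 (n : ℝ) ×ˢ Set.Icc 0 (n : ℝ)) ≠ ∞ := by
  refine ne_top_of_le_ne_top ?_ (Measure.restrict_apply_le _ _)
  rw [Measure.volume_eq_prod, Measure.prod_prod, Real.volume_Icc]
  exact ENNReal.mul_ne_top ENNReal.ofReal_ne_top ENNReal.ofReal_ne_top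

lemma IsQueueSolution.ae_isQueuePath {Ω : Type*} [MeasurableSpace Ω] {P : Measure Ω}
    {arr srv : Fin 2 → Ω → Set (ℝ × ℝ)} {lam mu : Fin 2 → ℝ} {x₀ : Fin 2 → ℕ}
    {L : ℝ → Ω → Fin 2 → ℕ} (hL : IsQueueSolution P arr srv lam mu x₀ L)
    (hN : IsPoissonNoise P arr srv) :
    ∀ᵐ ω ∂P, IsQueuePath (fun i => arr i ω) (fun i => srv i ω) lam mu x₀ (fun t => L t ω) := by
  have hA : ∀ᵐ ω ∂P, ∀ i, ∀ n : ℕ,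
      (arr i ω ∩ Set.Icc 0 (n : ℝ) ×ˢ Set.Icc 0 (n : ℝ)).Finite :=
    ae_all_iff.2 fun i => ae_all_iff.2 fun n => (hN.arr_poisson i).ae_finite
      (measurableSet_Icc.prod measurableSet_Icc) (quadrantIntensity_square_ne_top n)
  have hS : ∀ᵐ ω ∂P, ∀ i, ∀ n : ℕ,
      (srv i ω ∩ Set.Icc 0 (n : ℝ) ×ˢ Set.Icc 0 (n : ℝ)).Finite :=
    ae_all_iff.2 fun i => ae_all_iff.2 fun n => (hN.srv_poisson i).ae_finite
      (measurableSet_Icc.prod measurableSet_Icc) (quadrantIntensity_square_ne_top n)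
  filter_upwards [hA, hS, hL] with ω h1 h2 h3
  exact ⟨h1, h2, h3⟩

/-! ### The drift of the first queue -/

lemma alphaStar_pos {ρ : ℝ} (h0 : 0 < ρ) (h1 : ρ < 1) : 0 < alphaStar ρ :=
  div_pos h0 (sub_pos.2 h1)

lemma alphaStar_lt_one {ρ : ℝ} (h1 : ρ < 1 / 2) : alphaStar ρ < 1 := by
  rw [alphaStar, div_lt_one (by linarith)]
  linarith

lemma one_sub_mul_alphaStar {ρ : ℝ} (h1 : ρ < 1) : (1 - ρ) * alphaStar ρ = ρ := by
  rw [alphaStar, mul_div_cancel₀ _ (by linarith)]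

/-- Above the curve `x₁ = a x₂ ^ α*` with `a > 1`, the first queue gets more than its share `ρ₁`
of the service, by a margin of order `1 / log N`. -/
lemma exists_add_div_le_serviceShare {ρ a : ℝ} (hρ0 : 0 < ρ) (hρ1 : ρ < 1) (ha : 1 < a) :
    ∃ c > 0, ∀ᶠ y : ℕ in atTop, ∀ (x : Fin 2 → ℕ) (q : ℝ), y ≤ x 1 → 1 ≤ q →
      Real.log (1 + x 1) ≤ 2 * q → a * (x 1 : ℝ) ^ alphaStar ρ ≤ x 0 →
      ρ + c / q ≤ serviceShare x 0 := by
  set α := alphaStar ρ with hα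
  have hα0 : 0 < α := alphaStar_pos hρ0 hρ1
  have hαρ : (1 - ρ) * α = ρ := one_sub_mul_alphaStar hρ1
  -- Half of log a; the other half absorbs α (log(1 + x₁) - log x₁) ≤ α/x₁, where x₁ denotes `x 1`.
  set d := Real.log a / 2 with hd
  have hd0 : 0 < d := half_pos (Real.log_pos ha)
  have h1ρ : 0 < 1 - ρ := by linarith
  -- With p, r the two logarithms and D = p - αr ≥ d, the excess share is (1 - ρ)D/(D + (1 + α)r).
  -- It increases with D and r ≤ 2q, so D = d together with q ≥ 1 gives this constant.
  set c := (1 - ρ) * d / (d + 2 * (1 + α)) with hc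
  have hden : 0 < d + 2 * (1 + α) := by positivity
  have hc0 : 0 < c := by positivity
  have hcd : c * (d + 2 * (1 + α)) = (1 - ρ) * d := by
    rw [hc]
    field_simp
  refine ⟨c, hc0, ?_⟩
  filter_upwards [(tendsto_natCast_atTop_atTop (R := ℝ)).eventually_ge_atTop (α / d + 1)]
    with y hy x q hyx hq hlog hx
  have hx1 : α / d + 1 ≤ (x 1 : ℝ) := hy.trans (by exact_mod_cast hyx)
  have hx1pos : (0 : ℝ) < x 1 := by
    have : 0 < α / d := by positivity
    linarith
  set p := Real.log (1 + (x 0 : ℝ)) with hp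
  set r := Real.log (1 + (x 1 : ℝ)) with hr
  have hr0 : 0 < r := Real.log_pos (by linarith)
  have hpow : 0 < (x 1 : ℝ) ^ α := Real.rpow_pos_of_pos hx1pos _
  have h1 : Real.log a + α * Real.log (x 1) ≤ p := by
    rw [← Real.log_rpow hx1pos, ← Real.log_mul (by linarith) hpow.ne']
    exact Real.log_le_log (by positivity) (by linarith)
  have h2 : r ≤ Real.log (x 1) + 1 / x 1 := by
    have e : (1 : ℝ) + x 1 = x 1 * (1 + 1 / x 1) := by
      field_simp
      ring
    rw [hr, e, Real.log_mul hx1pos.ne' (by positivity)]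
    have := Real.log_le_sub_one_of_pos (x := 1 + 1 / (x 1 : ℝ)) (by positivity)
    linarith
  have h3 : α * (1 / x 1) ≤ d := by
    rw [mul_one_div, div_le_iff₀ hx1pos]
    have : α / d ≤ x 1 := by linarith
    rwa [div_le_iff₀ hd0, mul_comm] at this
  have hD : d ≤ p - α * r := by
    have := mul_le_mul_of_nonneg_left h2 hα0.le
    have : Real.log a = 2 * d := by rw [hd]; ring
    linarith [mul_add α (Real.log (x 1)) (1 / x 1)]
  have hp0 : 0 < p := by nlinarith
  change ρ + c / q ≤ p / (p + r)
  rw [le_div_iff₀ (by positivity), add_mul]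
  have hq0 : 0 < q := by linarith
  have h4 : c / q * (p + r) ≤ (1 - ρ) * (p - α * r) := by
    have e : p + r = (p - α * r) + (1 + α) * r := by ring
    rw [e, div_mul_eq_mul_div, div_le_iff₀ hq0]
    set D := p - α * r
    have g1 : c * ((1 + α) * r) ≤ c * (2 * (1 + α)) * q := by
      have := mul_le_mul_of_nonneg_left hlog (by positivity : 0 ≤ c * (1 + α))
      linarith
    have g2 : c * (2 * (1 + α)) = (1 - ρ) * d - c * d := by linarith
    have g3 : c ≤ 1 - ρ := by
      rw [hc, div_le_iff₀ hden]
      gcongr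
      linarith
    have g4 : c * D ≤ c * D * q := le_mul_of_one_le_right (mul_nonneg hc0.le (hd0.le.trans hD)) hq
    have g5 : 0 ≤ ((1 - ρ) - c) * (D - d) * q :=
      mul_nonneg (mul_nonneg (by linarith) (by linarith)) hq0.le
    nlinarith
  have h5 : (1 - ρ) * (p - α * r) = p - ρ * (p + r) := by
    linear_combination -r * hαρ
  linarith

/-- Below the curve `x₁ = a x₂ ^ α*` with `a < 1`, the first queue gets less than its share `ρ₁`
of the service, by a margin of order `1 / log N`. -/
lemma exists_serviceShare_le_sub_div {ρ a : ℝ} (hρ0 : 0 < ρ) (hρ1 : ρ < 1) (ha0 : 0 < a)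
    (ha : a < 1) :
    ∃ c > 0, ∀ᶠ y : ℕ in atTop, ∀ (x : Fin 2 → ℕ) (q : ℝ), y ≤ x 1 → 1 ≤ q →
      Real.log (1 + x 1) ≤ 2 * q → (x 0 : ℝ) ≤ a * (x 1 : ℝ) ^ alphaStar ρ →
      serviceShare x 0 ≤ ρ - c / q := by
  set α := alphaStar ρ with hα
  have hα0 : 0 < α := alphaStar_pos hρ0 hρ1
  have hαρ : (1 - ρ) * α = ρ := one_sub_mul_alphaStar hρ1
  -- The midpoint (1 + a)/2 leaves room for the 1 in log(1 + x₀): 1 + a y^α ≤ ((1 + a)/2) y^α for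
  -- large y.
  set d := -Real.log ((1 + a) / 2) with hd
  have hd0 : 0 < d := neg_pos.2 (Real.log_neg (by linarith) (by linarith))
  have h1ρ : 0 < 1 - ρ := by linarith
  set c := (1 - ρ) * d / (2 * (1 + α)) with hc
  have hc0 : 0 < c := by positivity
  have hcd : c * (2 * (1 + α)) = (1 - ρ) * d := by
    rw [hc]
    field_simp
  refine ⟨c, hc0, ?_⟩
  have hlim : ∀ᶠ y : ℝ in atTop, y ^ (-α) ≤ (1 - a) / 2 :=
    (tendsto_rpow_neg_atTop hα0).eventually_le_const (by linarith)
  obtain ⟨Y, hY⟩ := eventually_atTop.1 hlim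
  filter_upwards [(tendsto_natCast_atTop_atTop (R := ℝ)).eventually_ge_atTop (max Y 1)]
    with y hy x q hyx hq hlog hx
  have hx1 : max Y 1 ≤ (x 1 : ℝ) := hy.trans (by exact_mod_cast hyx)
  have hx1pos : (0 : ℝ) < x 1 := zero_lt_one.trans_le ((le_max_right _ _).trans hx1)
  have hYx := hY _ ((le_max_left _ _).trans hx1)
  set p := Real.log (1 + (x 0 : ℝ)) with hp
  set r := Real.log (1 + (x 1 : ℝ)) with hr
  have hr0 : 0 < r := Real.log_pos (by linarith)
  have hp0 : 0 ≤ p := Real.log_nonneg (by linarith [(x 0).cast_nonneg (α := ℝ)])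
  have hpow : 0 < (x 1 : ℝ) ^ α := Real.rpow_pos_of_pos hx1pos _
  have h1 : p ≤ -d + α * Real.log (x 1) := by
    rw [hd, neg_neg, ← Real.log_rpow hx1pos, ← Real.log_mul (by linarith) hpow.ne']
    refine Real.log_le_log (by positivity) ?_
    rw [Real.rpow_neg hx1pos.le, inv_le_iff_one_le_mul₀ hpow] at hYx
    linarith
  have h2 : Real.log (x 1) ≤ r := Real.log_le_log hx1pos (by linarith)
  have hD : d ≤ α * r - p := by
    have := mul_le_mul_of_nonneg_left h2 hα0.le
    linarith
  change p / (p + r) ≤ ρ - c / q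
  rw [div_le_iff₀ (by positivity), sub_mul]
  have hq0 : 0 < q := by linarith
  have h4 : c / q * (p + r) ≤ (1 - ρ) * (α * r - p) := by
    rw [div_mul_eq_mul_div, div_le_iff₀ hq0]
    calc c * (p + r) ≤ c * ((1 + α) * (2 * q)) := by
            have : p + r ≤ (1 + α) * r := by linarith
            refine mul_le_mul_of_nonneg_left (this.trans ?_) hc0.le
            gcongr
      _ = (1 - ρ) * d * q := by rw [← hcd]; ring
      _ ≤ (1 - ρ) * (α * r - p) * q := by gcongr
  have h5 : (1 - ρ) * (α * r - p) = ρ * (p + r) - p := by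
    linear_combination r * hαρ
  linarith

/-! ### Asymptotic comparisons -/

lemma eventually_one_le_log_natCast : ∀ᶠ N : ℕ in atTop, 1 ≤ Real.log N :=
  (Real.tendsto_log_atTop.comp (tendsto_natCast_atTop_atTop (R := ℝ))).eventually_ge_atTop 1

lemma eventually_mul_log_le_rpow {β : ℝ} (hβ : 0 < β) (r : ℝ) {q : ℝ} (hq : 0 < q) :
    ∀ᶠ N : ℕ in atTop, r * Real.log N ≤ q * (N : ℝ) ^ β := by
  have h := ((isLittleO_log_rpow_atTop hβ).def (c := q / (|r| + 1)) (by positivity))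
  filter_upwards [(tendsto_natCast_atTop_atTop (R := ℝ)).eventually h,
    eventually_one_le_log_natCast] with N hN hl
  rw [Real.norm_of_nonneg (by linarith), Real.norm_of_nonneg (by positivity),
    div_mul_eq_mul_div, le_div_iff₀ (by positivity)] at hN
  have : r * Real.log N ≤ (|r| + 1) * Real.log N := by
    gcongr
    linarith [le_abs_self r]
  linarith

/-- This is where α* < 1, that is ρ₁ < 1/2, matters: working off N^α at speed 1/log N takes time N^α
log N, negligible against N. -/
lemma eventually_mul_rpow_le_div_log_mul {α : ℝ} (hα : α < 1) (r : ℝ) {q : ℝ} (hq : 0 < q) :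
    ∀ᶠ N : ℕ in atTop, r * (N : ℝ) ^ α ≤ q / Real.log N * N := by
  filter_upwards [eventually_mul_log_le_rpow (sub_pos.2 hα) r hq, eventually_one_le_log_natCast,
    eventually_gt_atTop 0] with N hN hl hN0
  have hN0' : (0 : ℝ) < N := by exact_mod_cast hN0
  rw [div_mul_eq_mul_div, le_div_iff₀ (by linarith)]
  calc r * (N : ℝ) ^ α * Real.log N = (r * Real.log N) * (N : ℝ) ^ α := by ring
    _ ≤ q * (N : ℝ) ^ (1 - α) * (N : ℝ) ^ α := by gcongr
    _ = q * N := by rw [mul_assoc, ← Real.rpow_add hN0', sub_add_cancel, Real.rpow_one]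

/-- The square counts pairs of grid times. Since log N ≤ N^(α/2) eventually, the exponent is at
least of order N^(α/2), and N² is a power of N^(α/2). -/
lemma tendsto_sq_mul_exp_div_log {α q e : ℝ} (hα : 0 < α) (hq : 0 < q) (he : 0 < e) (r : ℝ)
    {η : ℝ} (hη : 0 < η) :
    Tendsto (fun N : ℕ => ((⌈η * N⌉₊ : ℝ) + 1) ^ 2 *
      Real.exp (q / Real.log N * (r - e * (N : ℝ) ^ α))) atTop (𝓝 0) := by
  have hlim : Tendsto (fun N : ℕ => ((η + 2) ^ 2 * Real.exp (q * |r|)) *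
      (((N : ℝ) ^ (α / 2)) ^ (4 / α) * Real.exp (-(q * e) * (N : ℝ) ^ (α / 2)))) atTop (𝓝 0) := by
    rw [show (0 : ℝ) = ((η + 2) ^ 2 * Real.exp (q * |r|)) * 0 from (mul_zero _).symm]
    exact Tendsto.const_mul _ <| (tendsto_rpow_mul_exp_neg_mul_atTop_nhds_zero (4 / α) (q * e)
      (by positivity)).comp ((tendsto_rpow_atTop (half_pos hα)).comp (tendsto_natCast_atTop_atTop (R := ℝ)))
  refine squeeze_zero' (Eventually.of_forall fun N => by positivity) ?_ hlim
  filter_upwards [eventually_mul_log_le_rpow (half_pos hα) 1 one_pos,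
    eventually_one_le_log_natCast, eventually_gt_atTop 0] with N hN hl hN0
  have hN0' : (0 : ℝ) < N := by exact_mod_cast hN0
  have hN1 : (1 : ℝ) ≤ N := by exact_mod_cast hN0
  rw [one_mul, one_mul] at hN
  have hl0 : 0 < Real.log N := by linarith
  have e1 : ((⌈η * N⌉₊ : ℝ) + 1) ^ 2 ≤ (η + 2) ^ 2 * ((N : ℝ) ^ (α / 2)) ^ (4 / α) := by
    have : ((N : ℝ) ^ (α / 2)) ^ (4 / α) = (N : ℝ) ^ 2 := by
      rw [← Real.rpow_mul hN0'.le, ← Real.rpow_natCast]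
      congr 1
      field_simp
      norm_num
    rw [this, ← mul_pow]
    have := (Nat.ceil_lt_add_one (by positivity : 0 ≤ η * N)).le
    gcongr
    nlinarith
  have e2 : Real.exp (q / Real.log N * (r - e * (N : ℝ) ^ α)) ≤
      Real.exp (q * |r|) * Real.exp (-(q * e) * (N : ℝ) ^ (α / 2)) := by
    rw [← Real.exp_add]
    refine Real.exp_le_exp.2 ?_
    rw [div_mul_eq_mul_div, div_le_iff₀ hl0]
    have h1 : q * |r| ≤ q * |r| * Real.log N := le_mul_of_one_le_right (by positivity) hl
    have h2 : q * r ≤ q * |r| := by gcongr; exact le_abs_self r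
    have h3 : q * e * (N : ℝ) ^ (α / 2) * Real.log N ≤ q * e * (N : ℝ) ^ α := by
      calc q * e * (N : ℝ) ^ (α / 2) * Real.log N
          ≤ q * e * (N : ℝ) ^ (α / 2) * (N : ℝ) ^ (α / 2) := by gcongr
        _ = q * e * (N : ℝ) ^ α := by
          rw [mul_assoc, ← Real.rpow_add hN0', add_halves]
    nlinarith
  calc _ ≤ ((η + 2) ^ 2 * ((N : ℝ) ^ (α / 2)) ^ (4 / α)) *
      (Real.exp (q * |r|) * Real.exp (-(q * e) * (N : ℝ) ^ (α / 2))) := by gcongr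
    _ = _ := by ring

lemma tendsto_sq_mul_exp_neg {δ η : ℝ} (hδ : 0 < δ) (hη : 0 < η) :
    Tendsto (fun N : ℕ => ((⌈η * N⌉₊ : ℝ) + 1) ^ 2 * Real.exp (-(δ * N))) atTop (𝓝 0) := by
  refine squeeze_zero' (Eventually.of_forall fun N => by positivity) ?_
    (tendsto_sq_mul_exp_div_log one_pos one_pos hδ 0 hη)
  filter_upwards [eventually_one_le_log_natCast] with N hl
  gcongr
  rw [zero_sub, Real.rpow_one, mul_neg]
  refine neg_le_neg ?_
  exact mul_le_of_le_one_left (by positivity) (div_le_one_of_le₀ hl (by linarith))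

/-! ### Confinement of a path by the counts on a time grid -/

/-- The supremum of the visits need not be a visit; a visit less than one unit before it is enough,
and the lost unit of time is paid for in the grid estimates. -/
lemma exists_last_visit {G : ℝ → Prop} {t : ℝ} (ht : 0 ≤ t) (h0 : G 0) :
    ∃ s ∈ Set.Icc 0 t, G s ∧ ∀ v, s + 1 ≤ v → v ≤ t → ¬ G v := by
  set V : Set ℝ := {s | s ∈ Set.Icc 0 t ∧ G s} with hV
  have hne : V.Nonempty := ⟨0, ⟨le_rfl, ht⟩, h0⟩
  have hbdd : BddAbove V := ⟨t, fun s hs => hs.1.2⟩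
  obtain ⟨s, hs, hlt⟩ := exists_lt_of_lt_csSup hne (sub_one_lt (sSup V))
  refine ⟨s, hs.1, hs.2, fun v hv hvt hG => ?_⟩
  have : v ≤ sSup V := le_csSup hbdd ⟨⟨by linarith [hs.1.1], hvt⟩, hG⟩
  linarith

namespace IsQueuePath

variable {A S : Fin 2 → Set (ℝ × ℝ)} {lam mu : Fin 2 → ℝ} {x₀ : Fin 2 → ℕ} {l : ℝ → Fin 2 → ℕ}

/-- Arrivals are dropped, service is taken at full rate, and the time interval is rounded outward to
integers, so finitely many counts control all real times. -/
lemma sub_le_of_srv_lt (hl : IsQueuePath A S lam mu x₀ l) (hmu : ∀ i, 0 < mu i) (i : Fin 2)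
    {K : ℕ} {f : ℝ}
    (hK : ∀ j k : ℕ, j ≤ k → k ≤ K →
      ((S i ∩ strip (mu i) j k).ncard : ℝ) < 2 * (mu i * (k - j)) + f)
    {s t : ℝ} (hs : 0 ≤ s) (hst : s ≤ t) (htK : t ≤ K) :
    (l s i : ℝ) - l t i < 2 * (mu i * ((⌈t⌉₊ : ℝ) - ⌊s⌋₊)) + f := by
  have h1 := hl.increment hmu i hs hst
  have h2 : ((S i ∩ stripUnder (serviceRate mu l i) s t).ncard : ℝ) ≤
      (S i ∩ strip (mu i) (⌊s⌋₊ : ℝ) (⌈t⌉₊ : ℝ)).ncard := by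
    refine Nat.cast_le.2 (Set.ncard_le_ncard (Set.inter_subset_inter_right _ ?_)
      (finite_inter_strip (hl.srv_finite i) _ _ (Nat.cast_nonneg _)))
    rw [← stripUnder_const]
    exact stripUnder_subset_stripUnder (Nat.floor_le hs) (Nat.le_ceil t)
      fun u _ _ => serviceRate_le hmu l i u
  have h3 := hK ⌊s⌋₊ ⌈t⌉₊ ((Nat.floor_mono hst).trans (Nat.floor_le_ceil t)) (Nat.ceil_le.2 htK)
  have h4 : (0 : ℝ) ≤ (A i ∩ strip (lam i) s t).ncard := Nat.cast_nonneg _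
  linarith

lemma sub_le_of_arr_lt (hl : IsQueuePath A S lam mu x₀ l) (hmu : ∀ i, 0 < mu i) (i : Fin 2)
    {K : ℕ} {f : ℝ}
    (hK : ∀ j k : ℕ, j ≤ k → k ≤ K →
      ((A i ∩ strip (lam i) j k).ncard : ℝ) < 2 * (lam i * (k - j)) + f)
    {s t : ℝ} (hs : 0 ≤ s) (hst : s ≤ t) (htK : t ≤ K) :
    (l t i : ℝ) - l s i < 2 * (lam i * ((⌈t⌉₊ : ℝ) - ⌊s⌋₊)) + f := by
  have h1 := hl.increment hmu i hs hst
  have h2 : ((A i ∩ strip (lam i) s t).ncard : ℝ) ≤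
      (A i ∩ strip (lam i) (⌊s⌋₊ : ℝ) (⌈t⌉₊ : ℝ)).ncard := by
    refine Nat.cast_le.2 (Set.ncard_le_ncard (Set.inter_subset_inter_right _ ?_)
      (finite_inter_strip (hl.arr_finite i) _ _ (Nat.cast_nonneg _)))
    exact strip_subset_strip le_rfl (Nat.floor_le hs) (Nat.le_ceil t)
  have h3 := hK ⌊s⌋₊ ⌈t⌉₊ ((Nat.floor_mono hst).trans (Nat.floor_le_ceil t)) (Nat.ceil_le.2 htK)
  have h4 : (0 : ℝ) ≤ (S i ∩ stripUnder (serviceRate mu l i) s t).ncard := Nat.cast_nonneg _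
  linarith

/-- If queue `i` is served at rate at least `h` whenever the state violates `G`, its content since
the last visit of `G` is bounded by the difference of two counts of fixed rates. -/
lemma exists_sub_lt_of_le_rate (hl : IsQueuePath A S lam mu x₀ l) (hmu : ∀ i, 0 < mu i)
    (i : Fin 2) {K : ℕ} {h e g : ℝ}
    (hK : ∀ j k : ℕ, j ≤ k → k ≤ K →
      ((A i ∩ strip (lam i) j k).ncard : ℝ) - (S i ∩ strip h (j + 2) (k - 1)).ncard <
        e - g * (k - j))
    {G : (Fin 2 → ℕ) → Prop} (h0 : G (l 0))
    (hG : ∀ v : ℝ, 0 ≤ v → v ≤ K → ¬ G (l v) → h ≤ mu i * serviceShare (l v) i)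
    {t : ℝ} (ht : 0 ≤ t) (htK : t ≤ K) :
    ∃ s ∈ Set.Icc 0 t, G (l s) ∧ (l t i : ℝ) - l s i < e - g * ((⌈t⌉₊ : ℝ) - ⌊s⌋₊) := by
  obtain ⟨s, ⟨hs, hst⟩, hGs, hlast⟩ := exists_last_visit (G := fun v => G (l v)) ht h0
  refine ⟨s, ⟨hs, hst⟩, hGs, ?_⟩
  have h1 := hl.increment hmu i hs hst
  have h2 : ((A i ∩ strip (lam i) s t).ncard : ℝ) ≤
      (A i ∩ strip (lam i) (⌊s⌋₊ : ℝ) (⌈t⌉₊ : ℝ)).ncard := by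
    refine Nat.cast_le.2 (Set.ncard_le_ncard (Set.inter_subset_inter_right _ ?_)
      (finite_inter_strip (hl.arr_finite i) _ _ (Nat.cast_nonneg _)))
    exact strip_subset_strip le_rfl (Nat.floor_le hs) (Nat.le_ceil t)
  have hfl := Nat.lt_floor_add_one s
  have hce := Nat.ceil_lt_add_one ht
  -- `⌊s⌋₊ + 2` exceeds s + 1, after which `G` fails, and `⌈t⌉₊ - 1` is below t. The rate at u is
  -- read from the left limit, hence at some v in (s + 1, u).
  have h3 : ((S i ∩ strip h (⌊s⌋₊ + 2) (⌈t⌉₊ - 1)).ncard : ℝ) ≤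
      (S i ∩ stripUnder (serviceRate mu l i) s t).ncard := by
    refine Nat.cast_le.2 (Set.ncard_le_ncard (Set.inter_subset_inter_right _ ?_)
      (hl.finite_departures hmu i hs t))
    rw [← stripUnder_const]
    refine stripUnder_subset_stripUnder (by linarith) (by linarith) fun u hu1 hu2 => ?_
    obtain ⟨v, ⟨hv1, hv2⟩, hv⟩ := hl.exists_leftLim_eq hmu (by linarith : 0 ≤ s + 1)
      (by linarith : s + 1 < u)
    rw [serviceRate, hv]
    exact hG v (by linarith) (by linarith) (hlast v hv1.le (by linarith))
  have h4 := hK ⌊s⌋₊ ⌈t⌉₊ ((Nat.floor_mono hst).trans (Nat.floor_le_ceil t)) (Nat.ceil_le.2 htK)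
  linarith

/-- If queue `i` is served at rate at most `h` whenever the state violates `G`, the decrease of its
content since the last visit of `G` is bounded by the difference of two counts of fixed rates. -/
lemma exists_sub_lt_of_rate_le (hl : IsQueuePath A S lam mu x₀ l) (hmu : ∀ i, 0 < mu i)
    (i : Fin 2) {K : ℕ} {h e g : ℝ}
    (hK : ∀ j k : ℕ, j ≤ k → k ≤ K →
      ((S i ∩ (strip h j k ∪ strip (mu i) j (j + 2))).ncard : ℝ) -
        (A i ∩ strip (lam i) (j + 1) (k - 1)).ncard < e - g * (k - j))
    {G : (Fin 2 → ℕ) → Prop} (h0 : G (l 0))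
    (hG : ∀ v : ℝ, 0 ≤ v → v ≤ K → ¬ G (l v) → mu i * serviceShare (l v) i ≤ h)
    {t : ℝ} (ht : 0 ≤ t) (htK : t ≤ K) :
    ∃ s ∈ Set.Icc 0 t, G (l s) ∧ (l s i : ℝ) - l t i < e - g * ((⌈t⌉₊ : ℝ) - ⌊s⌋₊) := by
  obtain ⟨s, ⟨hs, hst⟩, hGs, hlast⟩ := exists_last_visit (G := fun v => G (l v)) ht h0
  refine ⟨s, ⟨hs, hst⟩, hGs, ?_⟩
  have h1 := hl.increment hmu i hs hst
  have hfl := Nat.lt_floor_add_one s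
  have hfl' := Nat.floor_le hs
  have hce := Nat.ceil_lt_add_one ht
  have h2 : ((A i ∩ strip (lam i) (⌊s⌋₊ + 1) (⌈t⌉₊ - 1)).ncard : ℝ) ≤
      (A i ∩ strip (lam i) s t).ncard := by
    refine Nat.cast_le.2 (Set.ncard_le_ncard (Set.inter_subset_inter_right _ ?_)
      (finite_inter_strip (hl.arr_finite i) _ _ hs))
    exact strip_subset_strip le_rfl (by linarith) (by linarith)
  -- Up to time s + 1 nothing is known about `G`, so services there are counted at full rate; s + 1
  -- < `⌊s⌋₊ + 2` explains the second strip.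
  have h3 : ((S i ∩ stripUnder (serviceRate mu l i) s t).ncard : ℝ) ≤
      (S i ∩ (strip h ⌊s⌋₊ ⌈t⌉₊ ∪ strip (mu i) ⌊s⌋₊ (⌊s⌋₊ + 2))).ncard := by
    refine Nat.cast_le.2 (Set.ncard_le_ncard (Set.inter_subset_inter_right _ ?_) ?_)
    · rintro p ⟨hp1, hp2, hp3, hp4⟩
      rcases le_or_gt p.2 (s + 1) with hp | hp
      · exact Or.inr ⟨⟨hp3, hp4.trans (serviceRate_le hmu l i _)⟩, by linarith, by linarith⟩
      · obtain ⟨v, ⟨hv1, hv2⟩, hv⟩ := hl.exists_leftLim_eq hmu (by linarith : 0 ≤ s + 1) hp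
        rw [serviceRate, hv] at hp4
        exact Or.inl ⟨⟨hp3, hp4.trans (hG v (by linarith) (by linarith)
          (hlast v hv1.le (by linarith)))⟩, by linarith, hp2.trans (Nat.le_ceil t)⟩
    · rw [Set.inter_union_distrib_left]
      exact (finite_inter_strip (hl.srv_finite i) _ _ (Nat.cast_nonneg _)).union
        (finite_inter_strip (hl.srv_finite i) _ _ (Nat.cast_nonneg _))
  have h4 := hK ⌊s⌋₊ ⌈t⌉₊ ((Nat.floor_mono hst).trans (Nat.floor_le_ceil t)) (Nat.ceil_le.2 htK)
  linarith

end IsQueuePath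

/-- A decrease of `y` by a small proportion changes `y ^ α` by a small proportion. -/
lemma rpow_le_one_add_mul_rpow {α y y' N D : ℝ} (hα0 : 0 ≤ α) (hα1 : α ≤ 1) (hN : 0 < N)
    (hy : N / 4 ≤ y) (hy' : 0 ≤ y') (hD : 0 ≤ D) (h : y' ≤ y + D * N) :
    y' ^ α ≤ (1 + 4 * D) * y ^ α := by
  have hy0 : 0 < y := by linarith
  have h1 : y' ≤ (1 + 4 * D) * y := by nlinarith
  calc y' ^ α ≤ ((1 + 4 * D) * y) ^ α := Real.rpow_le_rpow hy' h1 hα0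
    _ = (1 + 4 * D) ^ α * y ^ α := Real.mul_rpow (by positivity) hy0.le
    _ ≤ (1 + 4 * D) * y ^ α := by
      gcongr
      calc (1 + 4 * D) ^ α ≤ (1 + 4 * D) ^ (1 : ℝ) :=
            Real.rpow_le_rpow_of_exponent_le (by linarith) hα1
        _ = _ := Real.rpow_one _

lemma rpow_le_four_mul_rpow {α y N : ℝ} (hα0 : 0 ≤ α) (hα1 : α ≤ 1) (hN : 0 < N)
    (hy : N / 4 ≤ y) : N ^ α ≤ 4 * y ^ α := by
  have h := rpow_le_one_add_mul_rpow hα0 hα1 hN hy hN.le (by norm_num : (0 : ℝ) ≤ 3 / 4)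
    (by linarith)
  linarith

/-- Here (x, y) is the state at the last visit, (x', y') the state after a further time of about n.
If n ≥ τN, the drift gn would make x' negative. Otherwise y' is below y by at most (2mτ + δ)N, and
since y' ≥ N/4 both y^α and N^α are controlled by y'^α. -/
lemma le_mul_rpow_of_excursion {α a b C N x x' y y' n e g m δ τ : ℝ} (hα0 : 0 ≤ α) (hα1 : α ≤ 1)
    (ha : 0 ≤ a) (hN : 0 < N) (hy' : N / 4 ≤ y') (hy0 : 0 ≤ y) (hy : y ≤ C * N) (hx' : 0 ≤ x')
    (hx : x ≤ a * y ^ α) (hm : 0 ≤ m) (hn : 0 ≤ n) (hδ : 0 ≤ δ) (hτ : 0 ≤ τ) (he : 0 ≤ e)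
    (hg : 0 ≤ g) (hexc : x' - x < e * N ^ α - g * n) (hyy : y - y' < 2 * (m * n) + δ * N)
    (hlarge : a * (C * N) ^ α + e * N ^ α ≤ g * τ * N)
    (hb : a * (1 + 4 * (2 * m * τ + δ)) + 4 * e ≤ b) : x' ≤ b * y' ^ α := by
  rcases le_or_gt (τ * N) n with h | h
  · exfalso
    have h1 : a * y ^ α ≤ a * (C * N) ^ α := by gcongr
    have h2 : g * (τ * N) ≤ g * n := by gcongr
    linarith
  · have h1 : y ≤ y' + (2 * m * τ + δ) * N := by
      have := mul_le_mul_of_nonneg_left h.le hm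
      linarith
    have h2 := rpow_le_one_add_mul_rpow hα0 hα1 hN hy' hy0 (by positivity) h1
    have h3 := rpow_le_four_mul_rpow hα0 hα1 hN hy'
    have h4 : 0 ≤ y' ^ α := Real.rpow_nonneg (by linarith) _
    have h5 := mul_nonneg hg hn
    have h6 := mul_le_mul_of_nonneg_left h2 ha
    have h7 := mul_le_mul_of_nonneg_left h3 he
    have h8 := mul_le_mul_of_nonneg_right hb h4
    linarith

/-- Mirror image, with growth of y as the danger. A long excursion is no contradiction here: the
upward drift alone lifts x' above b(CN)^α ≥ b y'^α. -/
lemma mul_rpow_le_of_excursion {α a b C N x x' y y' n e g m δ τ : ℝ} (hα0 : 0 ≤ α) (hα1 : α ≤ 1)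
    (hb0 : 0 ≤ b) (hN : 0 < N) (hy : N / 4 ≤ y) (hy0 : 0 ≤ y') (hy' : y' ≤ C * N) (hx0 : 0 ≤ x)
    (hx : a * y ^ α ≤ x) (hm : 0 ≤ m) (hn : 0 ≤ n) (hδ : 0 ≤ δ) (hτ : 0 ≤ τ) (he : 0 ≤ e)
    (hg : 0 ≤ g) (hexc : x - x' < e * N ^ α - g * n) (hyy : y' - y < 2 * (m * n) + δ * N)
    (hlarge : b * (C * N) ^ α + e * N ^ α ≤ g * τ * N)
    (hb : b * (1 + 4 * (2 * m * τ + δ)) + 4 * e ≤ a) : b * y' ^ α ≤ x' := by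
  rcases le_or_gt (τ * N) n with h | h
  · have h1 : b * y' ^ α ≤ b * (C * N) ^ α := by gcongr
    have h2 : g * (τ * N) ≤ g * n := by gcongr
    linarith
  · have h1 : y' ≤ y + (2 * m * τ + δ) * N := by
      have := mul_le_mul_of_nonneg_left h.le hm
      linarith
    have h2 := rpow_le_one_add_mul_rpow hα0 hα1 hN hy hy0 (by positivity) h1
    have h3 := rpow_le_four_mul_rpow hα0 hα1 hN hy
    have h4 : 0 ≤ y ^ α := Real.rpow_nonneg (by linarith) _
    have h5 := mul_nonneg hg hn
    have h6 := mul_le_mul_of_nonneg_left h2 hb0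
    have h7 := mul_le_mul_of_nonneg_left h3 he
    have h8 := mul_le_mul_of_nonneg_right hb h4
    linarith

/-! ### Probability of large deviations on the time grid -/

lemma measure_exists_le_of_grid {Ω : Type*} [MeasurableSpace Ω] {P : Measure Ω}
    {E : ℕ → ℕ → Set Ω} {K : ℕ} {p : ℝ}
    (h : ∀ j k, j ≤ k → k ≤ K → P (E j k) ≤ ENNReal.ofReal p) :
    P {ω | ∃ j k, j ≤ k ∧ k ≤ K ∧ ω ∈ E j k} ≤ ENNReal.ofReal (((K : ℝ) + 1) ^ 2 * p) := by
  set I := ((Finset.range (K + 1)) ×ˢ (Finset.range (K + 1))).filter (fun q => q.1 ≤ q.2) with hI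
  have hsub : {ω | ∃ j k, j ≤ k ∧ k ≤ K ∧ ω ∈ E j k} ⊆ ⋃ q ∈ I, E q.1 q.2 := by
    rintro ω ⟨j, k, hjk, hk, hω⟩
    refine Set.mem_biUnion (x := (j, k)) ?_ hω
    simp only [hI, Finset.coe_filter, Finset.mem_product, Finset.mem_range]
    exact ⟨⟨by omega, by omega⟩, hjk⟩
  have hcard : I.card ≤ (K + 1) ^ 2 := by
    refine (Finset.card_filter_le _ _).trans ?_
    rw [Finset.card_product, Finset.card_range, sq]
  calc P {ω | ∃ j k, j ≤ k ∧ k ≤ K ∧ ω ∈ E j k} ≤ P (⋃ q ∈ I, E q.1 q.2) := measure_mono hsub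
    _ ≤ ∑ q ∈ I, P (E q.1 q.2) := measure_biUnion_finset_le _ _
    _ ≤ ∑ _q ∈ I, ENNReal.ofReal p := by
      refine Finset.sum_le_sum fun q hq => ?_
      simp only [hI, Finset.mem_filter, Finset.mem_product, Finset.mem_range] at hq
      exact h q.1 q.2 hq.2 (by omega)
    _ = (I.card : ℝ≥0∞) * ENNReal.ofReal p := by rw [Finset.sum_const, nsmul_eq_mul]
    _ ≤ (((K + 1) ^ 2 : ℕ) : ℝ≥0∞) * ENNReal.ofReal p := by gcongr
    _ = ENNReal.ofReal (((K : ℝ) + 1) ^ 2 * p) := by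
      rw [ENNReal.ofReal_mul (by positivity), ← ENNReal.ofReal_natCast]
      push_cast
      rfl

lemma measure_exists_two_mul_add_le {Ω : Type*} [MeasurableSpace Ω] {P : Measure Ω}
    {S S' : Ω → Set (ℝ × ℝ)} (hS : IsPoissonPointProcess P quadrantIntensity S)
    (hS' : IsPoissonPointProcess P quadrantIntensity S')
    (hind : Indep (pointSigma S) (pointSigma S') P) {h : ℝ} (hh : 0 ≤ h) (K : ℕ) (f : ℝ) :
    P {ω | ∃ j k : ℕ, j ≤ k ∧ k ≤ K ∧
        2 * (h * ((k : ℝ) - j)) + f ≤ ((S ω ∩ strip h j k).ncard : ℝ)} ≤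
      ENNReal.ofReal (((K : ℝ) + 1) ^ 2 * Real.exp (-f)) := by
  refine measure_exists_le_of_grid (E := fun j k => {ω | 2 * (h * ((k : ℝ) - j)) + f ≤
    ((S ω ∩ strip h j k).ncard : ℝ)}) fun j k hjk _ => ?_
  have hm := measure_two_mul_add_le_ncard hS hS' hind (measurableSet_strip h j k)
    (quadrantIntensity_strip_ne_top h k (Nat.cast_nonneg j)) f
  rwa [toReal_quadrantIntensity_strip hh (Nat.cast_nonneg j) (Nat.cast_le.2 hjk)] at hm

lemma measure_exists_arr_sub_srv_ge {Ω : Type*} [MeasurableSpace Ω] {P : Measure Ω}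
    {S S' : Ω → Set (ℝ × ℝ)} (hS : IsPoissonPointProcess P quadrantIntensity S)
    (hS' : IsPoissonPointProcess P quadrantIntensity S')
    (hind : Indep (pointSigma S) (pointSigma S') P) {h g M : ℝ} (hh : 0 ≤ h) (hg : 0 < g)
    (hM : h + g ≤ M) (K : ℕ) (x : ℝ) :
    P {ω | ∃ j k : ℕ, j ≤ k ∧ k ≤ K ∧ x - g / 2 * ((k : ℝ) - j) ≤
        ((S ω ∩ strip h j k).ncard : ℝ) - (S' ω ∩ strip (h + g) (j + 2) (k - 1)).ncard} ≤
      ENNReal.ofReal (((K : ℝ) + 1) ^ 2 * Real.exp (g / (4 * M) * (3 * (3 * M) - x))) := by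
  refine measure_exists_le_of_grid (E := fun j k => {ω | x - g / 2 * ((k : ℝ) - j) ≤
    ((S ω ∩ strip h j k).ncard : ℝ) - (S' ω ∩ strip (h + g) (j + 2) (k - 1)).ncard})
    fun j k hjk _ => ?_
  have hjk' : (j : ℝ) ≤ k := Nat.cast_le.2 hjk
  -- C = 3M: the service strip is three time units shorter than k - j, at a rate at most M.
  have hm := measure_le_ncard_sub_ncard_of_drift hS hS' hind (a := h) (b := h + g) (M := M)
    (C := 3 * M) (n := (k : ℝ) - j) (measurableSet_strip h j k)
    (quadrantIntensity_strip_ne_top h k (Nat.cast_nonneg j))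
    (measurableSet_strip (h + g) (j + 2) (k - 1))
    (quadrantIntensity_strip_ne_top _ _ (by positivity)) hh (by linarith) hM (by linarith)
    (by linarith)
    (by rw [toReal_quadrantIntensity_strip hh (Nat.cast_nonneg j) hjk']; linarith)
    (le_trans (by linarith) (mul_sub_le_toReal_quadrantIntensity_strip
      (by linarith : 0 ≤ h + g) (by positivity : (0 : ℝ) ≤ (j : ℝ) + 2))) x
  rwa [add_sub_cancel_left] at hm

lemma measure_exists_srv_sub_arr_ge {Ω : Type*} [MeasurableSpace Ω] {P : Measure Ω}
    {S S' : Ω → Set (ℝ × ℝ)} (hS : IsPoissonPointProcess P quadrantIntensity S)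
    (hS' : IsPoissonPointProcess P quadrantIntensity S')
    (hind : Indep (pointSigma S) (pointSigma S') P) {h m g : ℝ} (hm0 : 0 ≤ m) (hg : 0 < g)
    (hgh : g ≤ h) (K : ℕ) (x : ℝ) :
    P {ω | ∃ j k : ℕ, j ≤ k ∧ k ≤ K ∧ x - g / 2 * ((k : ℝ) - j) ≤
        ((S ω ∩ (strip (h - g) j k ∪ strip m j (j + 2))).ncard : ℝ) -
          (S' ω ∩ strip h (j + 1) (k - 1)).ncard} ≤
      ENNReal.ofReal (((K : ℝ) + 1) ^ 2 *
        Real.exp (g / (4 * h) * (3 * (2 * m + 2 * h) - x))) := by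
  refine measure_exists_le_of_grid (E := fun j k => {ω | x - g / 2 * ((k : ℝ) - j) ≤
    ((S ω ∩ (strip (h - g) j k ∪ strip m j (j + 2))).ncard : ℝ) -
      (S' ω ∩ strip h (j + 1) (k - 1)).ncard}) fun j k hjk _ => ?_
  have hjk' : (j : ℝ) ≤ k := Nat.cast_le.2 hjk
  have hne1 := quadrantIntensity_strip_ne_top (h - g) k (Nat.cast_nonneg (α := ℝ) j)
  have hne2 := quadrantIntensity_strip_ne_top m (j + 2) (Nat.cast_nonneg (α := ℝ) j)
  have hle := measure_union_le (μ := quadrantIntensity) (strip (h - g) j k) (strip m j (j + 2))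
  have hle' : (quadrantIntensity (strip (h - g) (j : ℝ) k ∪ strip m j (j + 2))).toReal ≤
      (h - g) * ((k : ℝ) - j) + (2 * m + 2 * h) := by
    refine (ENNReal.toReal_mono (ENNReal.add_ne_top.2 ⟨hne1, hne2⟩) hle).trans ?_
    rw [ENNReal.toReal_add hne1 hne2,
      toReal_quadrantIntensity_strip (by linarith) (Nat.cast_nonneg j) hjk',
      toReal_quadrantIntensity_strip hm0 (Nat.cast_nonneg j) (by linarith)]
    linarith
  -- C = 2m + 2h: two units of time at full service rate m, and an arrival strip two units shorter.
  have hm := measure_le_ncard_sub_ncard_of_drift hS hS' hind (a := h - g) (b := h) (M := h)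
    (C := 2 * m + 2 * h) (n := (k : ℝ) - j)
    ((measurableSet_strip (h - g) j k).union (measurableSet_strip m j (j + 2)))
    (ne_top_of_le_ne_top (ENNReal.add_ne_top.2 ⟨hne1, hne2⟩) hle)
    (measurableSet_strip h (j + 1) (k - 1))
    (quadrantIntensity_strip_ne_top _ _ (by positivity)) (by linarith) (by linarith) le_rfl
    (by linarith) (by linarith) hle'
    (le_trans (by linarith) (mul_sub_le_toReal_quadrantIntensity_strip
      (by linarith : 0 ≤ h) (by positivity : (0 : ℝ) ≤ (j : ℝ) + 1))) x
  rwa [sub_sub_cancel] at hm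

/-! ### Confinement with high probability -/

namespace IsQueuePath

variable {A S : Fin 2 → Set (ℝ × ℝ)} {lam mu : Fin 2 → ℝ} {x₀ : Fin 2 → ℕ} {l : ℝ → Fin 2 → ℕ}

/-- This fixes the time scale 1/(4 `mu 1`): the loss is at most N/2 + 2 `mu 1` + δN, where N = `x₀
1`, and the last two terms are at most N/8 each. -/
lemma second_queue_bounds (hl : IsQueuePath A S lam mu x₀ l) (hlam : ∀ i, 0 < lam i)
    (hmu : ∀ i, 0 < mu i) {δ : ℝ} (hδ : δ ≤ 1 / 8) (hN1 : 1 ≤ x₀ 1)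
    (hN : 16 * mu 1 ≤ x₀ 1)
    (hS : ∀ j k : ℕ, j ≤ k → k ≤ ⌈1 / (4 * mu 1) * x₀ 1⌉₊ →
      ((S 1 ∩ strip (mu 1) j k).ncard : ℝ) < 2 * (mu 1 * (k - j)) + δ * x₀ 1)
    (hA : ∀ j k : ℕ, j ≤ k → k ≤ ⌈1 / (4 * mu 1) * x₀ 1⌉₊ →
      ((A 1 ∩ strip (lam 1) j k).ncard : ℝ) < 2 * (lam 1 * (k - j)) + δ * x₀ 1)
    {t : ℝ} (ht : 0 ≤ t) (htK : t ≤ ⌈1 / (4 * mu 1) * x₀ 1⌉₊) :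
    (x₀ 1 : ℝ) / 4 ≤ l t 1 ∧
      (l t 1 : ℝ) ≤ (2 + 2 * lam 1 * (1 / (4 * mu 1) + 1)) * x₀ 1 := by
  have h1 := hl.sub_le_of_srv_lt hmu 1 hS le_rfl ht htK
  have h2 := hl.sub_le_of_arr_lt hmu 1 hA le_rfl ht htK
  have hm := hmu 1
  have hL := hlam 1
  have hN1' : (1 : ℝ) ≤ x₀ 1 := by exact_mod_cast hN1
  simp only [hl.initial, Nat.floor_zero, Nat.cast_zero, sub_zero] at h1 h2
  have hK : (⌈1 / (4 * mu 1) * x₀ 1⌉₊ : ℝ) ≤ 1 / (4 * mu 1) * x₀ 1 + 1 :=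
    (Nat.ceil_lt_add_one (by positivity)).le
  have ht' : (⌈t⌉₊ : ℝ) ≤ 1 / (4 * mu 1) * x₀ 1 + 1 :=
    (Nat.cast_le.2 (Nat.ceil_le.2 htK)).trans hK
  have h3 : mu 1 * ⌈t⌉₊ ≤ x₀ 1 / 4 + mu 1 := by
    have := mul_le_mul_of_nonneg_left ht' hm.le
    have e : mu 1 * (1 / (4 * mu 1) * (x₀ 1 : ℝ) + 1) = x₀ 1 / 4 + mu 1 := by field_simp
    linarith
  have h4 : lam 1 * ⌈t⌉₊ ≤ lam 1 * ((1 / (4 * mu 1) + 1) * x₀ 1) := by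
    refine mul_le_mul_of_nonneg_left (ht'.trans ?_) hL.le
    linarith
  have h5 : δ * x₀ 1 ≤ 1 / 8 * x₀ 1 := by gcongr
  constructor <;> linarith

end IsQueuePath

/-- Each of the three errors, 8amτ, 4aδ and 4e, gets at most a quarter of b - a. The bound 1/8 on δ
is the one used by `second_queue_bounds`. -/
lemma exists_margins {a b m : ℝ} (ha : 0 < a) (hab : a < b) (hm : 0 < m) :
    ∃ δ > 0, ∃ τ > 0, ∃ e > 0, δ ≤ 1 / 8 ∧ a * (1 + 4 * (2 * m * τ + δ)) + 4 * e ≤ b := by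
  have hd : 0 < b - a := sub_pos.2 hab
  refine ⟨min (1 / 8) ((b - a) / (16 * a)), by positivity, (b - a) / (32 * a * m), by positivity,
    (b - a) / 16, by positivity, min_le_left _ _, ?_⟩
  have h1 : a * min (1 / 8) ((b - a) / (16 * a)) ≤ (b - a) / 16 := by
    calc a * min (1 / 8) ((b - a) / (16 * a)) ≤ a * ((b - a) / (16 * a)) := by
          gcongr
          exact min_le_right _ _
      _ = (b - a) / 16 := by field_simp
  have h2 : a * (m * ((b - a) / (32 * a * m))) = (b - a) / 32 := by field_simp
  linarith

lemma eventually_log_le_two_mul_log (C : ℝ) :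
    ∀ᶠ N : ℕ in atTop, ∀ y : ℕ, (y : ℝ) ≤ C * N → Real.log (1 + y) ≤ 2 * Real.log N := by
  filter_upwards [(tendsto_natCast_atTop_atTop (R := ℝ)).eventually_ge_atTop (max (C + 1) 1)]
    with N hN y hy
  have h1 : (1 : ℝ) ≤ N := (le_max_right _ _).trans hN
  have h2 : C + 1 ≤ (N : ℝ) := (le_max_left _ _).trans hN
  have e : 2 * Real.log N = Real.log ((N : ℝ) ^ 2) := by rw [Real.log_pow]; norm_num
  rw [e]
  refine Real.log_le_log (by positivity) ?_
  nlinarith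

lemma IsPoissonNoise.indep {Ω : Type*} [MeasurableSpace Ω] {P : Measure Ω}
    {arr srv : Fin 2 → Ω → Set (ℝ × ℝ)} (hN : IsPoissonNoise P arr srv) (i j : Fin 2) :
    Indep (pointSigma (arr i)) (pointSigma (srv j)) P :=
  hN.independent.indep (i := Sum.inl i) (j := Sum.inr j) (by simp)

/-- Started below `a L₂ ^ α*` with `a > 1`, the first queue stays below `b L₂ ^ α*` for a time of
order `N`, for every `b > a`. -/
lemma exists_measure_upper_exit_le.{u} (lam mu : Fin 2 → ℝ) (hlam : ∀ i, 0 < lam i)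
    (hmu : ∀ i, 0 < mu i) (hρ₁ : lam 0 / mu 0 < 1 / 2) {a b : ℝ} (ha : 1 < a) (hab : a < b) :
    ∃ p : ℕ → ℝ≥0∞, Tendsto p atTop (𝓝 0) ∧ ∀ᶠ N : ℕ in atTop, ∀ (n₁ : ℕ),
      (n₁ : ℝ) ≤ a * (N : ℝ) ^ alphaStar (lam 0 / mu 0) →
      ∀ (Ω : Type u) [MeasurableSpace Ω] (P : Measure Ω) (arr srv : Fin 2 → Ω → Set (ℝ × ℝ))
        (L : ℝ → Ω → Fin 2 → ℕ), IsPoissonNoise P arr srv →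
        IsQueueSolution P arr srv lam mu ![n₁, N] L →
        P {ω | ∃ t ∈ Set.Icc (0 : ℝ) (1 / (4 * mu 1) * N), ¬ (0 < L t ω 1 ∧
          (L t ω 0 : ℝ) ≤ b * (L t ω 1 : ℝ) ^ alphaStar (lam 0 / mu 0))} ≤ p N := by
  set ρ := lam 0 / mu 0 with hρ
  have hρ0 : 0 < ρ := div_pos (hlam 0) (hmu 0)
  have hlamρ : lam 0 = mu 0 * ρ := by rw [hρ, mul_div_cancel₀ _ (hmu 0).ne']
  set α := alphaStar ρ with hα
  have hα0 : 0 < α := alphaStar_pos hρ0 (by linarith)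
  have hα1 : α < 1 := alphaStar_lt_one hρ₁
  have hη : 0 < 1 / (4 * mu 1) := by have := hmu 1; positivity
  set η := 1 / (4 * mu 1) with hηdef
  obtain ⟨δ, hδ, τ, hτ, e, he, hδ8, hmargin⟩ :=
    exists_margins (by linarith : 0 < a) hab (hmu 1)
  obtain ⟨c, hc, hdrift⟩ := exists_add_div_le_serviceShare hρ0 (by linarith : ρ < 1) ha
  obtain ⟨Y, hY⟩ := eventually_atTop.1 hdrift
  have hg : 0 < mu 0 * c := mul_pos (hmu 0) hc
  set g := mu 0 * c with hgdef
  set C := 2 + 2 * lam 1 * (η + 1) with hC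
  have hC0 : 0 < C := by have := hlam 1; positivity
  set M := lam 0 + g with hM
  have hM0 : 0 < M := add_pos (hlam 0) hg
  set p : ℕ → ℝ := fun N => ((⌈η * N⌉₊ : ℝ) + 1) ^ 2 * Real.exp (-(δ * N)) with hp
  set p' : ℕ → ℝ := fun N => ((⌈η * N⌉₊ : ℝ) + 1) ^ 2 *
    Real.exp (g / (4 * M) / Real.log N * (3 * (3 * M) - e * (N : ℝ) ^ α)) with hp'
  -- One term each for the services of the second queue, its arrivals, and the excursions of the
  -- first queue. None depends on `n₁` or on the probability space.
  refine ⟨fun N => ENNReal.ofReal (p N) + ENNReal.ofReal (p N) + ENNReal.ofReal (p' N), ?_, ?_⟩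
  · have h1 := ENNReal.tendsto_ofReal (tendsto_sq_mul_exp_neg hδ hη)
    have h2 := ENNReal.tendsto_ofReal (tendsto_sq_mul_exp_div_log hα0
      (by positivity : 0 < g / (4 * M)) he (3 * (3 * M)) hη)
    rw [ENNReal.ofReal_zero] at h1 h2
    simpa using (h1.add h1).add h2
  filter_upwards [eventually_one_le_log_natCast, eventually_log_le_two_mul_log C,
    eventually_mul_rpow_le_div_log_mul hα1 (a * C ^ α + e) (by positivity : 0 < g / 2 * τ),
    eventually_ge_atTop 1, eventually_ge_atTop (4 * Y),
    (tendsto_natCast_atTop_atTop (R := ℝ)).eventually_ge_atTop (16 * mu 1)]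
    with N hlog hlog2 hlarge hN1 hNY hN16 n₁ hn₁ Ω _ P arr srv L hnoise hsol
  have hN0 : (0 : ℝ) < N := by exact_mod_cast hN1
  have hlog0 : 0 < Real.log N := by linarith
  have hG : 0 < g / Real.log N := div_pos hg hlog0
  have hGM : lam 0 + g / Real.log N ≤ M := by
    have := div_le_self hg.le hlog
    linarith
  set K := ⌈η * N⌉₊ with hK
  have b1 := measure_exists_two_mul_add_le (hnoise.srv_poisson 1) (hnoise.arr_poisson 1)
    (hnoise.indep 1 1).symm (hmu 1).le K (δ * N)
  have b2 := measure_exists_two_mul_add_le (hnoise.arr_poisson 1) (hnoise.srv_poisson 1)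
    (hnoise.indep 1 1) (hlam 1).le K (δ * N)
  have b3 := measure_exists_arr_sub_srv_ge (hnoise.arr_poisson 0) (hnoise.srv_poisson 0)
    (hnoise.indep 0 0) (hlam 0).le hG hGM K (e * (N : ℝ) ^ α)
  rw [div_right_comm g (Real.log N) (4 * M)] at b3
  refine (measure_mono_ae ?_).trans ((measure_union_le _ _).trans (add_le_add
    ((measure_union_le _ _).trans (add_le_add b1 b2)) b3))
  filter_upwards [hsol.ae_isQueuePath hnoise] with ω hl hω
  by_contra hgood
  obtain ⟨t, ⟨ht0, htT⟩, hbad⟩ := hω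
  change ¬ (_ ∨ _) at hgood
  rw [not_or] at hgood
  obtain ⟨hgood, hg3⟩ := hgood
  change ¬ (_ ∨ _) at hgood
  rw [not_or] at hgood
  obtain ⟨hg1, hg2⟩ := hgood
  simp only [Set.mem_ofPred_eq, not_exists, not_and, not_le] at hg1 hg2 hg3
  apply hbad
  have htK : t ≤ K := htT.trans (Nat.le_ceil _)
  have hband : ∀ v : ℝ, 0 ≤ v → v ≤ K → (N : ℝ) / 4 ≤ L v ω 1 ∧ (L v ω 1 : ℝ) ≤ C * N :=
    fun v hv hvK => hl.second_queue_bounds hlam hmu hδ8 hN1 hN16 hg1 hg2 hv hvK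
  have hpos : ∀ v : ℝ, 0 ≤ v → v ≤ K → (0 : ℝ) < L v ω 1 := fun v hv hvK =>
    lt_of_lt_of_le (by positivity) (hband v hv hvK).1
  refine ⟨by exact_mod_cast hpos t ht0 htK, ?_⟩
  -- `G` is the region below the inner curve; outside it the drift estimate applies with q = log N.
  obtain ⟨s, ⟨hs0, hst⟩, hGs, hinc⟩ := hl.exists_sub_lt_of_le_rate hmu 0 hg3
    (G := fun x => (x 0 : ℝ) ≤ a * (x 1 : ℝ) ^ α) (by rw [hl.initial]; exact hn₁)
    (fun v hv hvK hnG => by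
      have h := hY Y le_rfl (L v ω) (Real.log N) ?_ hlog (hlog2 _ (hband v hv hvK).2)
        (not_le.1 hnG).le
      · have := mul_le_mul_of_nonneg_left h (hmu 0).le
        rw [mul_add, ← hlamρ, ← mul_div_assoc] at this
        exact this
      · have h4 : (4 * Y : ℝ) ≤ N := by exact_mod_cast hNY
        have : (Y : ℝ) ≤ L v ω 1 := le_trans (by linarith) (hband v hv hvK).1
        exact_mod_cast this) ht0 htK
  have hn : (0 : ℝ) ≤ (⌈t⌉₊ : ℝ) - ⌊s⌋₊ :=
    sub_nonneg.2 (Nat.cast_le.2 ((Nat.floor_mono hst).trans (Nat.floor_le_ceil t)))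
  refine le_mul_rpow_of_excursion hα0.le hα1.le (by linarith) hN0 (hband t ht0 htK).1
    (Nat.cast_nonneg _) (hband s hs0 (hst.trans htK)).2 (Nat.cast_nonneg _) hGs (hmu 1).le hn
    hδ.le hτ.le he.le (half_pos hG).le hinc (hl.sub_le_of_srv_lt hmu 1 hg1 hs0 hst htK) ?_ hmargin
  rw [Real.mul_rpow hC0.le hN0.le]
  calc _ = (a * C ^ α + e) * (N : ℝ) ^ α := by ring
    _ ≤ g / 2 * τ / Real.log N * N := hlarge
    _ = _ := by ring

/-- Started above `a L₂ ^ α*` with `a < 1`, the first queue stays above `b L₂ ^ α*` for a time of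
order `N`, for every `b < a`. -/
lemma exists_measure_lower_exit_le.{u} (lam mu : Fin 2 → ℝ) (hlam : ∀ i, 0 < lam i)
    (hmu : ∀ i, 0 < mu i) (hρ₁ : lam 0 / mu 0 < 1 / 2) {a b : ℝ} (hb : 0 < b) (hab : b < a)
    (ha : a < 1) :
    ∃ p : ℕ → ℝ≥0∞, Tendsto p atTop (𝓝 0) ∧ ∀ᶠ N : ℕ in atTop, ∀ (n₁ : ℕ),
      a * (N : ℝ) ^ alphaStar (lam 0 / mu 0) ≤ n₁ →
      ∀ (Ω : Type u) [MeasurableSpace Ω] (P : Measure Ω) (arr srv : Fin 2 → Ω → Set (ℝ × ℝ))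
        (L : ℝ → Ω → Fin 2 → ℕ), IsPoissonNoise P arr srv →
        IsQueueSolution P arr srv lam mu ![n₁, N] L →
        P {ω | ∃ t ∈ Set.Icc (0 : ℝ) (1 / (4 * mu 1) * N), ¬ (0 < L t ω 1 ∧
          b * (L t ω 1 : ℝ) ^ alphaStar (lam 0 / mu 0) ≤ L t ω 0)} ≤ p N := by
  set ρ := lam 0 / mu 0 with hρ
  have hρ0 : 0 < ρ := div_pos (hlam 0) (hmu 0)
  have hlamρ : lam 0 = mu 0 * ρ := by rw [hρ, mul_div_cancel₀ _ (hmu 0).ne']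
  set α := alphaStar ρ with hα
  have hα0 : 0 < α := alphaStar_pos hρ0 (by linarith)
  have hα1 : α < 1 := alphaStar_lt_one hρ₁
  have hη : 0 < 1 / (4 * mu 1) := by have := hmu 1; positivity
  set η := 1 / (4 * mu 1) with hηdef
  obtain ⟨δ, hδ, τ, hτ, e, he, hδ8, hmargin⟩ := exists_margins hb hab (hlam 1)
  obtain ⟨c, hc, hdrift⟩ := exists_serviceShare_le_sub_div hρ0 (by linarith : ρ < 1)
    (hb.trans hab) ha
  obtain ⟨Y, hY⟩ := eventually_atTop.1 hdrift
  have hg : 0 < mu 0 * c := mul_pos (hmu 0) hc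
  set g := mu 0 * c with hgdef
  set C := 2 + 2 * lam 1 * (η + 1) with hC
  have hC0 : 0 < C := by have := hlam 1; positivity
  have hlam0 := hlam 0
  set p : ℕ → ℝ := fun N => ((⌈η * N⌉₊ : ℝ) + 1) ^ 2 * Real.exp (-(δ * N)) with hp
  set p' : ℕ → ℝ := fun N => ((⌈η * N⌉₊ : ℝ) + 1) ^ 2 * Real.exp (g / (4 * lam 0) / Real.log N *
    (3 * (2 * mu 0 + 2 * lam 0) - e * (N : ℝ) ^ α)) with hp'
  refine ⟨fun N => ENNReal.ofReal (p N) + ENNReal.ofReal (p N) + ENNReal.ofReal (p' N), ?_, ?_⟩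
  · have h1 := ENNReal.tendsto_ofReal (tendsto_sq_mul_exp_neg hδ hη)
    have h2 := ENNReal.tendsto_ofReal (tendsto_sq_mul_exp_div_log hα0
      (by positivity : 0 < g / (4 * lam 0)) he (3 * (2 * mu 0 + 2 * lam 0)) hη)
    rw [ENNReal.ofReal_zero] at h1 h2
    simpa using (h1.add h1).add h2
  filter_upwards [eventually_one_le_log_natCast, eventually_log_le_two_mul_log C,
    eventually_mul_rpow_le_div_log_mul hα1 (b * C ^ α + e) (by positivity : 0 < g / 2 * τ),
    eventually_ge_atTop 1, eventually_ge_atTop (4 * Y),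
    (tendsto_natCast_atTop_atTop (R := ℝ)).eventually_ge_atTop (16 * mu 1),
    -- Ensures that the reduced service rate `lam 0` - g/log N is non-negative.
    (Real.tendsto_log_atTop.comp (tendsto_natCast_atTop_atTop (R := ℝ))).eventually_ge_atTop
      (g / lam 0)]
    with N hlog hlog2 hlarge hN1 hNY hN16 hlogg n₁ hn₁ Ω _ P arr srv L hnoise hsol
  have hN0 : (0 : ℝ) < N := by exact_mod_cast hN1
  have hlog0 : 0 < Real.log N := by linarith
  have hG : 0 < g / Real.log N := div_pos hg hlog0
  have hGlam : g / Real.log N ≤ lam 0 := by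
    rw [div_le_iff₀ hlog0, mul_comm]
    exact (div_le_iff₀ hlam0).1 hlogg
  set K := ⌈η * N⌉₊ with hK
  have b1 := measure_exists_two_mul_add_le (hnoise.srv_poisson 1) (hnoise.arr_poisson 1)
    (hnoise.indep 1 1).symm (hmu 1).le K (δ * N)
  have b2 := measure_exists_two_mul_add_le (hnoise.arr_poisson 1) (hnoise.srv_poisson 1)
    (hnoise.indep 1 1) (hlam 1).le K (δ * N)
  have b3 := measure_exists_srv_sub_arr_ge (hnoise.srv_poisson 0) (hnoise.arr_poisson 0)
    (hnoise.indep 0 0).symm (hmu 0).le hG hGlam K (e * (N : ℝ) ^ α)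
  rw [div_right_comm g (Real.log N) (4 * lam 0)] at b3
  refine (measure_mono_ae ?_).trans ((measure_union_le _ _).trans (add_le_add
    ((measure_union_le _ _).trans (add_le_add b1 b2)) b3))
  filter_upwards [hsol.ae_isQueuePath hnoise] with ω hl hω
  by_contra hgood
  obtain ⟨t, ⟨ht0, htT⟩, hbad⟩ := hω
  change ¬ (_ ∨ _) at hgood
  rw [not_or] at hgood
  obtain ⟨hgood, hg3⟩ := hgood
  change ¬ (_ ∨ _) at hgood
  rw [not_or] at hgood
  obtain ⟨hg1, hg2⟩ := hgood
  simp only [Set.mem_ofPred_eq, not_exists, not_and, not_le] at hg1 hg2 hg3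
  apply hbad
  have htK : t ≤ K := htT.trans (Nat.le_ceil _)
  have hband : ∀ v : ℝ, 0 ≤ v → v ≤ K → (N : ℝ) / 4 ≤ L v ω 1 ∧ (L v ω 1 : ℝ) ≤ C * N :=
    fun v hv hvK => hl.second_queue_bounds hlam hmu hδ8 hN1 hN16 hg1 hg2 hv hvK
  have hpos : ∀ v : ℝ, 0 ≤ v → v ≤ K → (0 : ℝ) < L v ω 1 := fun v hv hvK =>
    lt_of_lt_of_le (by positivity) (hband v hv hvK).1
  refine ⟨by exact_mod_cast hpos t ht0 htK, ?_⟩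
  obtain ⟨s, ⟨hs0, hst⟩, hGs, hinc⟩ := hl.exists_sub_lt_of_rate_le hmu 0 hg3
    (G := fun x => a * (x 1 : ℝ) ^ α ≤ x 0) (by rw [hl.initial]; exact hn₁)
    (fun v hv hvK hnG => by
      have h := hY Y le_rfl (L v ω) (Real.log N) ?_ hlog (hlog2 _ (hband v hv hvK).2)
        (not_le.1 hnG).le
      · have := mul_le_mul_of_nonneg_left h (hmu 0).le
        rw [mul_sub, ← hlamρ, ← mul_div_assoc] at this
        exact this
      · have h4 : (4 * Y : ℝ) ≤ N := by exact_mod_cast hNY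
        have : (Y : ℝ) ≤ L v ω 1 := le_trans (by linarith) (hband v hv hvK).1
        exact_mod_cast this) ht0 htK
  have hn : (0 : ℝ) ≤ (⌈t⌉₊ : ℝ) - ⌊s⌋₊ :=
    sub_nonneg.2 (Nat.cast_le.2 ((Nat.floor_mono hst).trans (Nat.floor_le_ceil t)))
  refine mul_rpow_le_of_excursion hα0.le hα1.le hb.le hN0 (hband s hs0 (hst.trans htK)).1
    (Nat.cast_nonneg _) (hband t ht0 htK).2 (Nat.cast_nonneg _) hGs (hlam 1).le hn
    hδ.le hτ.le he.le (half_pos hG).le hinc (hl.sub_le_of_arr_lt hmu 1 hg2 hs0 hst htK) ?_ hmargin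
  rw [Real.mul_rpow hC0.le hN0.le]
  calc _ = (b * C ^ α + e) * (N : ℝ) ^ α := by ring
    _ ≤ g / 2 * τ / Real.log N * N := hlarge
    _ = _ := by ring

lemma abs_div_sub_one_le_iff {x y κ : ℝ} (hy : 0 < y) :
    |x / y - 1| ≤ κ ↔ (1 - κ) * y ≤ x ∧ x ≤ (1 + κ) * y := by
  rw [abs_le, ← le_div_iff₀ hy, ← div_le_iff₀ hy]
  constructor <;> rintro ⟨h1, h2⟩ <;> constructor <;> linarith

lemma ratioDev_le_ofReal_iff {α κ : ℝ} (hκ : 0 ≤ κ) {x y : ℕ} (hy : 0 < y) :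
    ratioDev α x y ≤ ENNReal.ofReal κ ↔
      (1 - κ) * (y : ℝ) ^ α ≤ x ∧ (x : ℝ) ≤ (1 + κ) * (y : ℝ) ^ α := by
  rw [ratioDev, if_neg hy.ne', ENNReal.ofReal_le_ofReal_iff hκ,
    abs_div_sub_one_le_iff (Real.rpow_pos_of_pos (by exact_mod_cast hy) _)]

/-- The limsup bound places the start within κ + ε/2 eventually; the levels 1 ± (κ + ε/2) and 1 ± (κ
+ ε) then serve as inner and outer levels. -/
lemma tendsto_measure_supRatioDev_gt.{u} (lam mu : Fin 2 → ℝ) (hlam : ∀ i, 0 < lam i)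
    (hmu : ∀ i, 0 < mu i) (hρ₁ : lam 0 / mu 0 < 1 / 2) {κ ε : ℝ} (hκ : 0 < κ) (hε : 0 < ε)
    (l : ℕ → ℕ)
    (hl : limsup (fun N : ℕ => ratioDev (alphaStar (lam 0 / mu 0)) (l N) N) atTop
      ≤ ENNReal.ofReal κ)
    (Ω : ℕ → Type u) [∀ N, MeasurableSpace (Ω N)] (P : ∀ N, Measure (Ω N))
    (arr srv : ∀ N, Fin 2 → Ω N → Set (ℝ × ℝ)) (L : ∀ N, ℝ → Ω N → Fin 2 → ℕ)
    (hnoise : ∀ N, IsPoissonNoise (P N) (arr N) (srv N))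
    (hsol : ∀ N, IsQueueSolution (P N) (arr N) (srv N) lam mu ![l N, N] (L N)) :
    Tendsto (fun N : ℕ => P N {ω | ENNReal.ofReal (κ + ε) <
      supRatioDev (alphaStar (lam 0 / mu 0)) (L N) (1 / (4 * mu 1) * N) ω}) atTop (𝓝 0) := by
  set α := alphaStar (lam 0 / mu 0) with hα
  have hinit : ∀ᶠ N : ℕ in atTop, (1 - (κ + ε / 2)) * (N : ℝ) ^ α ≤ l N ∧
      (l N : ℝ) ≤ (1 + (κ + ε / 2)) * (N : ℝ) ^ α := by
    have h := eventually_lt_of_limsup_lt (hl.trans_lt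
      ((ENNReal.ofReal_lt_ofReal_iff (by positivity)).2 (by linarith : κ < κ + ε / 2)))
    filter_upwards [h, eventually_gt_atTop 0] with N hN hN0
    exact (ratioDev_le_ofReal_iff (by positivity) hN0).1 hN.le
  obtain ⟨p, hp, hup⟩ := exists_measure_upper_exit_le.{u} lam mu hlam hmu hρ₁
    (by linarith : 1 < 1 + (κ + ε / 2)) (by linarith : 1 + (κ + ε / 2) < 1 + (κ + ε))
  obtain ⟨p', hp', hdn⟩ : ∃ p' : ℕ → ℝ≥0∞, Tendsto p' atTop (𝓝 0) ∧ ∀ᶠ N : ℕ in atTop,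
      P N {ω | ∃ t ∈ Set.Icc (0 : ℝ) (1 / (4 * mu 1) * N),
        (L N t ω 0 : ℝ) < (1 - (κ + ε)) * (L N t ω 1 : ℝ) ^ α} ≤ p' N := by
    -- If κ + ε ≥ 1 the lower barrier is non-positive and cannot be crossed. Positivity of the
    -- second queue is already part of the upper exit event.
    rcases le_or_gt (1 - (κ + ε)) 0 with h | h
    · refine ⟨0, tendsto_const_nhds, Eventually.of_forall fun N => ?_⟩
      refine (measure_mono (t := ∅) ?_).trans measure_empty.le
      rintro ω ⟨t, -, ht⟩
      have h1 : (1 - (κ + ε)) * (L N t ω 1 : ℝ) ^ α ≤ 0 :=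
        mul_nonpos_of_nonpos_of_nonneg h (by positivity)
      have h2 : (0 : ℝ) ≤ L N t ω 0 := Nat.cast_nonneg _
      linarith
    · obtain ⟨p', hp', hdn⟩ := exists_measure_lower_exit_le.{u} lam mu hlam hmu hρ₁ h
        (by linarith : 1 - (κ + ε) < 1 - (κ + ε / 2)) (by linarith)
      refine ⟨p', hp', ?_⟩
      filter_upwards [hdn, hinit] with N hN hN'
      refine (measure_mono ?_).trans (hN (l N) hN'.1 (Ω N) (P N) (arr N) (srv N) (L N)
        (hnoise N) (hsol N))
      rintro ω ⟨t, ht, htb⟩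
      exact ⟨t, ht, fun h => absurd h.2 (not_le.2 htb)⟩
  refine tendsto_of_tendsto_of_tendsto_of_le_of_le' tendsto_const_nhds
    (by simpa using hp.add hp') (Eventually.of_forall fun N => zero_le) ?_
  filter_upwards [hup, hdn, hinit] with N hN hN' hN0
  refine (measure_mono ?_).trans ((measure_union_le _ _).trans (add_le_add
    (hN (l N) hN0.2 (Ω N) (P N) (arr N) (srv N) (L N) (hnoise N) (hsol N)) hN'))
  intro ω hω
  simp only [Set.mem_ofPred_eq, supRatioDev, lt_iSup_iff] at hω
  obtain ⟨t, ht, hdev⟩ := hω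
  by_contra hcon
  change ¬ (_ ∨ _) at hcon
  rw [not_or] at hcon
  have h1 : 0 < L N t ω 1 ∧ (L N t ω 0 : ℝ) ≤ (1 + (κ + ε)) * (L N t ω 1 : ℝ) ^ α := by
    by_contra h
    exact hcon.1 ⟨t, ht, h⟩
  have h2 : (1 - (κ + ε)) * (L N t ω 1 : ℝ) ^ α ≤ L N t ω 0 := by
    by_contra h
    exact hcon.2 ⟨t, ht, not_le.1 h⟩
  exact absurd hdev (not_lt.2 ((ratioDev_le_ofReal_iff (by positivity) h1.1).2 ⟨h2, h1.2⟩))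


theorem theorem2 (lam mu : Fin 2 → ℝ) (hlam : ∀ i, 0 < lam i) (hmu : ∀ i, 0 < mu i)
    (hρ₁ : lam 0 / mu 0 < 1 / 2) (hρ : lam 0 / mu 0 + lam 1 / mu 1 < 1)
    (κ : ℝ) (hκ : 0 < κ) :
    ∃ η₀ : ℝ, 0 < η₀ ∧
      ∀ l : ℕ → ℕ,
        limsup (fun N : ℕ => ratioDev (alphaStar (lam 0 / mu 0)) (l N) N) atTop
            ≤ ENNReal.ofReal κ →
        ∀ (Ω : ℕ → Type*) [∀ N, MeasurableSpace (Ω N)] (P : ∀ N, Measure (Ω N))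
          [∀ N, IsProbabilityMeasure (P N)]
          (arr srv : ∀ N, Fin 2 → Ω N → Set (ℝ × ℝ)) (L : ∀ N, ℝ → Ω N → Fin 2 → ℕ),
          (∀ N, IsPoissonNoise (P N) (arr N) (srv N)) →
          (∀ N, IsQueueSolution (P N) (arr N) (srv N) lam mu ![l N, N] (L N)) →
          (∀ ε : ℝ, 0 < ε →
            Tendsto (fun N : ℕ => P N {ω | ENNReal.ofReal (κ + ε) <
                supRatioDev (alphaStar (lam 0 / mu 0)) (L N) (η₀ * N) ω}) atTop (𝓝 0)) ∧
          (limsup (fun N : ℕ => ratioDev (alphaStar (lam 0 / mu 0)) (l N) N) atTop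
              < ENNReal.ofReal κ →
            Tendsto (fun N : ℕ => P N {ω | ENNReal.ofReal κ <
                supRatioDev (alphaStar (lam 0 / mu 0)) (L N) (η₀ * N) ω}) atTop (𝓝 0)) := by
  have hm := hmu 1
  refine ⟨1 / (4 * mu 1), by positivity, ?_⟩
  intro l hl Ω _ P _ arr srv L hnoise hsol
  refine ⟨fun ε hε => tendsto_measure_supRatioDev_gt lam mu hlam hmu hρ₁ hκ hε l hl Ω P arr srv L
    hnoise hsol, fun hlt => ?_⟩
  -- The strict inequality leaves room for some r between the limsup and κ; part (i) for r with ε =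
  -- κ - r is the claim.
  obtain ⟨r, hr1, hr2⟩ := exists_between hlt
  have hr : ENNReal.ofReal r.toReal = r := ENNReal.ofReal_toReal (ne_top_of_lt hr2)
  have hr0 : 0 < r.toReal :=
    ENNReal.toReal_pos (ne_zero_of_lt hr1) (ne_top_of_lt hr2)
  have hrκ : r.toReal < κ := by
    rwa [← hr, ENNReal.ofReal_lt_ofReal_iff hκ] at hr2
  have h := tendsto_measure_supRatioDev_gt lam mu hlam hmu hρ₁ hr0 (sub_pos.2 hrκ) l
    (by rw [hr]; exact hr1.le) Ω P arr srv L hnoise hsol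
  rwa [add_sub_cancel] at h
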